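/- Fix $m\in\mathbb N$, $m\ge 1$. The preferential attachment multigraph $G_m^n$ is defined as follows. $G_1^0$ is the null graph; given $G_1^{t-1}$ on the vertices $v_1,\dots,v_{t-1}$, the multigraph $G_1^t$ is obtained by adding a vertex $v_t$ and a single edge from $v_t$ to a random vertex $v_i$, where $\mathbb P(i=s)=\deg(v_s,t-1)/(2t-1)$ for $1\le s\le t-1$ and $\mathbb P(i=t)=1/(2t-1)$; here $\deg(v_s,t-1)$ is the degree of $v_s$ in $G_1^{t-1}$, loops being counted twice. $G_m^n$ is obtained from $G_1^{mn}$ by identifying the first $m$ vertices to form the first vertex, the next $m$ vertices to form the second vertex, and so on, keeping all loops and multiple edges. The modularity of a multigraph $G$ with edge set $E(G)$ is $$q^*(G)=\max_{\mathcal A}\sum_{A\in\mathcal A}\left(\frac{e(A)}{|E(G)|}-\frac{\left(\sum_{v\in A}\deg(v)\right)^2}{4|E(G)|^2}\right),$$ where the maximum is over all partitions $\mathcal A$ of $V(G)$, $e(A)$ is the number of edges of $G$ with all endpoints in $A$, and edges are counted with multiplicity (a loop counts once as an edge and twice in the degree). An event holds asymptotically almost surely (a.a.s.) if its probability tends to $1$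 as $n\to\infty$ with $m$ fixed. **Theorem.** For every fixed $m\ge 1$, a.a.s. $$q^*(G_m^n)\ \ge\ \frac{\mathbb E\left|\mathrm{Bin}(m,1/2)-m/2\right|}{m}+o(1),$$ where $o(1)$ is a deterministic function of $n$ (for the given $m$) tending to $0$ as $n\to\infty$. Moreover, $$\frac{\mathbb E\left|\mathrm{Bin}(m,1/2)-m/2\right|}{m}=L(m):=\begin{cases}\dfrac{2^{1-m}}{m}\displaystyle\sum_{i=1}^{m/2} i\binom{m}{m/2+i} & \text{if } m \text{ is even},\\[2ex] \dfrac{2^{1-m}}{m}\displaystyle\sum_{i=1}^{(m+1)/2}\left(i-\tfrac12\right)\binom{m}{(m-1)/2+i} & \text{if } m \text{ is odd},\end{cases}$$ that is, a.a.s. $q^*(G_m^n)\ge L(m)+o(1)$. In particular, a.a.s. $q^*(G_m^n)=\Omega(1/\sqrt m)$: there is an absolute constant $c>0$ such that for every fixed $m\ge1$, a.a.s. $q^*(G_m^n)\ge c/\sqrt m$. -/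

import Mathlib

open Filter Topology MeasureTheory
open scoped ENNReal

noncomputable section

/-- A multigraph with vertex set `V` and (labelled) edges `E`; multiple edges and loops allowed. -/
@[ext]
structure Multigraph (V E : Type*) where
  /-- the unordered pair of endpoints of an edge (a diagonal pair for a loop) -/
  ends : E → Sym2 V

namespace Multigraph

variable {V W E : Type*}

instance : MeasurableSpace (Multigraph V E) := ⊤

instance : DiscreteMeasurableSpace (Multigraph V E) := ⟨fun _ => trivial⟩

/-- The degree of a vertex; every loop at the vertex is counted twice. -/
def deg [DecidableEq V] [Fintype E] (G : Multigraph V E) (v : V) : ℕ :=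
  ∑ e, (G.ends e).toMultiset.count v

/-- `e(A)`: the number of edges (with multiplicity, loops included) with all endpoints in `A`. -/
def edgesWithin [Fintype V] [DecidableEq V] [Fintype E] (G : Multigraph V E) (A : Finset V) : ℕ :=
  (Finset.univ.filter fun e : E => ∀ v ∈ G.ends e, v ∈ A).card

/-- The modularity `q_𝒜` of a partition `𝒜` of the vertex set. -/
def partitionModularity [Fintype V] [DecidableEq V] [Fintype E] (G : Multigraph V E)
    (P : Finpartition (Finset.univ : Finset V)) : ℝ :=
  ∑ A ∈ P.parts,
    ((G.edgesWithin A : ℝ) / (Fintype.card E : ℝ)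
      - (∑ v ∈ A, (G.deg v : ℝ)) ^ 2 / (4 * (Fintype.card E : ℝ) ^ 2))

/-- The modularity `q*(G)`: the maximum of `q_𝒜` over all partitions `𝒜` of the vertex set. -/
def modularity [Fintype V] [DecidableEq V] [Fintype E] (G : Multigraph V E) : ℝ :=
  (Finset.univ : Finset (Finpartition (Finset.univ : Finset V))).sup'
    ⟨⊥, Finset.mem_univ _⟩ G.partitionModularity

/-- The multigraph obtained by identifying vertices according to `f`; all edges are kept. -/
def mapVertices (f : V → W) (G : Multigraph V E) : Multigraph W E :=
  ⟨fun e => (G.ends e).map f⟩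

/-- Handshake identity: the degrees sum to twice the number of edges. -/
theorem sum_deg [Fintype V] [DecidableEq V] [Fintype E] (G : Multigraph V E) :
    ∑ v, G.deg v = 2 * Fintype.card E := by
  unfold deg
  rw [Finset.sum_comm]
  have h : ∀ e : E, ∑ v, (G.ends e).toMultiset.count v = 2 := fun e => by
    rw [Multiset.sum_count_eq_card (fun a _ => Finset.mem_univ a), Sym2.card_toMultiset]
  simp [h, mul_comm]

/-- Add a new vertex `Fin.last t` to a multigraph on `Fin t`, together with a single new edge
joining the new vertex to the vertex `i` (a loop if `i` is the new vertex itself). -/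
def addVertex {t : ℕ} (G : Multigraph (Fin t) (Fin t)) (i : Fin (t + 1)) :
    Multigraph (Fin (t + 1)) (Fin (t + 1)) :=
  ⟨Fin.snoc (α := fun _ => Sym2 (Fin (t + 1)))
    (fun e => (G.ends e).map Fin.castSucc) s(Fin.last t, i)⟩

/-- The probability that the new vertex `Fin.last t` of the preferential attachment process is
joined to `i`: it is `deg i / (2 t + 1)` for an old vertex `i`, and `1 / (2 t + 1)` for `i` the new
vertex. (The new vertex is the `(t + 1)`-st one, and `2 (t + 1) - 1 = 2 t + 1`.) -/
def attachProb {t : ℕ} (G : Multigraph (Fin t) (Fin t)) (i : Fin (t + 1)) : ℝ≥0∞ :=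
  Fin.snoc (α := fun _ => ℝ≥0∞) (fun s : Fin t => (G.deg s : ℝ≥0∞) / (2 * t + 1))
    (1 / (2 * t + 1)) i

theorem sum_attachProb {t : ℕ} (G : Multigraph (Fin t) (Fin t)) :
    ∑ i, G.attachProb i = 1 := by
  have h : (∑ v, (G.deg v : ℝ≥0∞)) = 2 * t := by
    have := G.sum_deg
    rw [Fintype.card_fin] at this
    exact_mod_cast this
  rw [Fin.sum_univ_castSucc]
  simp only [attachProb, Fin.snoc_castSucc, Fin.snoc_last, div_eq_mul_inv]
  rw [← Finset.sum_mul, h, ← add_mul]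
  refine ENNReal.mul_inv_cancel (by simp) ?_
  exact_mod_cast ENNReal.natCast_ne_top (2 * t + 1)

/-- The law of the random neighbour chosen by the new vertex. -/
def attach {t : ℕ} (G : Multigraph (Fin t) (Fin t)) : PMF (Fin (t + 1)) :=
  PMF.ofFintype G.attachProb G.sum_attachProb

end Multigraph

open Multigraph

/-- The law of the preferential attachment multigraph `G_1^t` (on `t` vertices, with `t` edges),
starting from the null graph. -/
def prefAttachOne : (t : ℕ) → PMF (Multigraph (Fin t) (Fin t))
  | 0 => PMF.pure ⟨Fin.elim0⟩
  | t + 1 => (prefAttachOne t).bind fun G => G.attach.map G.addVertex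

/-- The law of the preferential attachment multigraph `G_m^n` (on `n` vertices, with `n * m`
edges): it is obtained from `G_1^{nm}` by identifying the first `m` vertices to form the first
vertex, the next `m` vertices to form the second one, and so on. -/
def prefAttach (m n : ℕ) : PMF (Multigraph (Fin n) (Fin (n * m))) :=
  (prefAttachOne (n * m)).map (mapVertices Fin.divNat)

/-- "Asymptotically almost surely `q*(G_m^n) ≥ b n`": the probability tends to `1` as `n → ∞`. -/
def AASModularityGE (m : ℕ) (b : ℕ → ℝ) : Prop :=
  Tendsto (fun n : ℕ => (prefAttach m n).toMeasure {G | b n ≤ G.modularity}) atTop (𝓝 1)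

/-- `E |Bin(m, 1/2) - m/2|`. -/
def binomialMeanDeviation (m : ℕ) : ℝ :=
  ∫ k : ℕ, |(k : ℝ) - (m : ℝ) / 2|
    ∂(ProbabilityTheory.binomial m ⟨1 / 2, by norm_num, by norm_num⟩)

/-- The explicit binomial sum, for even and for odd `m`. -/
def explicitBound (m : ℕ) : ℝ :=
  if Even m then
    (2 : ℝ) ^ (1 - (m : ℤ)) / m *
      ∑ i ∈ Finset.Icc 1 (m / 2), (i : ℝ) * (m.choose (m / 2 + i) : ℝ)
  else
    (2 : ℝ) ^ (1 - (m : ℤ)) / m *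
      ∑ i ∈ Finset.Icc 1 ((m + 1) / 2), ((i : ℝ) - 1 / 2) * (m.choose ((m - 1) / 2 + i) : ℝ)

end

noncomputable section

open Multigraph

/-! The lower bound comes from a two-part partition built online along the attachment process. When
a block of `m` vertices (a vertex of the final multigraph) is complete, it receives the majority
colour among the targets of its edges. If coloured targets were fair coin flips, a block would gain
on average the mean absolute value `walkMeanAbs m` of an `m`-step simple random walk, which is twice
the binomial mean deviation. A colouring with signs ±1 has modularity `edgeProd / (2M) - edgeSum² /
(8M²)`, where `M = nm`, so this gives the bound once the degree-weighted bias is o(n).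

Targets are nearly fair only while the bias is small compared with time, and the majority rule
reinforces the bias. Hence the first `k₀ ≈ δn` blocks are simply coloured against the current bias,
and the majority rule starts afterwards, with ties broken against the bias. Early on, the mean
squared bias is O(t^(7/4)). From time `k₀ m` to `n m` the feedback multiplies this by at most a
power of `1/δ`, a constant, so it remains o(n²).

Bias and gain are controlled together. `biasPot` and `gainPot` replace the unfinished part of the
block by its average over a fair walk, so their drift comes only from the bias and from edges inside
the block. `Consistent.sum_potential_next_le` bounds the one-step growth of the sum of their
squares, `meanPotential_le` solves the recurrence, and Markov's inequality with
`Consistent.le_modularity` concludes. Finally δ → 0 with a diagonal choice of the error. -/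

/-! ### Simple random walk averages -/

/-- The average of a function over the two neighbours of an integer: one step of the transition
operator of simple random walk. -/
def stepAvg (h : ℤ → ℝ) : ℤ → ℝ := fun x => (h (x + 1) + h (x - 1)) / 2

theorem stepAvg_iterate_apply (n : ℕ) (h : ℤ → ℝ) (x : ℤ) :
    stepAvg^[n] h x = ∑ k ∈ Finset.range (n + 1),
      (n.choose k : ℝ) * (h (x + 2 * k - n) / 2 ^ n) := by
  induction n generalizing h with
  | zero => simp
  | succ n ih =>
    have key := Finset.sum_choose_succ_mul
      (fun i j => h (x + i - j) / (2 : ℝ) ^ (n + 1)) n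
    have h1 : ∀ k ∈ Finset.range (n + 2), ((n + 1).choose k : ℝ) *
        (h (x + 2 * k - (n + 1 : ℕ)) / 2 ^ (n + 1)) = ((n + 1).choose k : ℝ) *
        (h (x + k - (n + 1 - k : ℕ)) / 2 ^ (n + 1)) := by
      intro k hk
      have : k ≤ n + 1 := by simpa [Nat.lt_succ_iff] using hk
      congr 3
      push_cast [this]
      ring
    rw [Function.iterate_succ_apply, ih, Finset.sum_congr rfl h1, key, ← Finset.sum_add_distrib]
    refine Finset.sum_congr rfl fun k hk => ?_
    have hk : k ≤ n := by simpa [Nat.lt_succ_iff] using hk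
    have e1 : x + (k : ℤ) - ((n + 1 - k : ℕ) : ℤ) = x + 2 * k - n - 1 := by
      push_cast [hk.trans n.le_succ]; ring
    have e2 : x + ((k + 1 : ℕ) : ℤ) - ((n - k : ℕ) : ℤ) = x + 2 * k - n + 1 := by
      push_cast [hk]; ring
    simp only [stepAvg, e1, e2]
    ring

theorem stepAvg_iterate_mono {f g : ℤ → ℝ} (h : ∀ x, f x ≤ g x) (n : ℕ) (x : ℤ) :
    stepAvg^[n] f x ≤ stepAvg^[n] g x := by
  induction n generalizing x with
  | zero => exact h x
  | succ n ih =>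
    simp only [Function.iterate_succ_apply', stepAvg]
    linarith [ih (x + 1), ih (x - 1)]

theorem abs_stepAvg_iterate_le {h : ℤ → ℝ} {B : ℝ} (hB : ∀ x, |h x| ≤ B) (n : ℕ) (x : ℤ) :
    |stepAvg^[n] h x| ≤ B := by
  induction n generalizing x with
  | zero => exact hB x
  | succ n ih =>
    simp only [Function.iterate_succ_apply', stepAvg]
    have h1 := abs_le.1 (ih (x + 1))
    have h2 := abs_le.1 (ih (x - 1))
    exact abs_le.2 ⟨by linarith, by linarith⟩

theorem abs_stepAvg_iterate_sub_le {h : ℤ → ℝ} {B : ℝ} (hB : ∀ x, |h (x + 1) - h x| ≤ B)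
    (n : ℕ) (x : ℤ) : |stepAvg^[n] h (x + 1) - stepAvg^[n] h x| ≤ B := by
  induction n generalizing x with
  | zero => exact hB x
  | succ n ih =>
    simp only [Function.iterate_succ_apply', stepAvg]
    have h1 := abs_le.1 (ih (x + 1))
    have h2 := abs_le.1 (ih (x - 1))
    have e : x - 1 + 1 = x := by ring
    have e' : x + 1 - 1 = x := by ring
    rw [e] at h2
    rw [e']
    exact abs_le.2 ⟨by linarith, by linarith⟩

/-- The walk is symmetric, so averaging preserves the sign of the even part. At `x = 0` this fixes
the sign of the expected colour of a fresh block. -/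
theorem stepAvg_iterate_add_neg_nonneg {h : ℤ → ℝ} {c : ℝ} (hc : ∀ x, 0 ≤ c * (h x + h (-x)))
    (n : ℕ) (x : ℤ) : 0 ≤ c * (stepAvg^[n] h x + stepAvg^[n] h (-x)) := by
  induction n generalizing x with
  | zero => exact hc x
  | succ n ih =>
    simp only [Function.iterate_succ_apply', stepAvg]
    have h1 := ih (x + 1)
    have h2 := ih (x - 1)
    rw [show -(x + 1) = -x - 1 by ring] at h1
    rw [show -(x - 1) = -x + 1 by ring] at h2
    linarith

theorem stepAvg_iterate_const (c : ℝ) (n : ℕ) (x : ℤ) : stepAvg^[n] (fun _ => c) x = c := by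
  induction n generalizing x with
  | zero => rfl
  | succ n ih => simp only [Function.iterate_succ_apply', stepAvg, ih]; ring

theorem stepAvg_iterate_linear (c : ℝ) (n : ℕ) (x : ℤ) :
    stepAvg^[n] (fun y => c * y) x = c * x := by
  induction n generalizing x with
  | zero => rfl
  | succ n ih => simp only [Function.iterate_succ_apply', stepAvg, ih]; push_cast; ring

theorem stepAvg_iterate_sq_sub_pow_four (a b : ℝ) (n : ℕ) (x : ℤ) :
    stepAvg^[n] (fun y => a * (y : ℝ) ^ 2 - b * (y : ℝ) ^ 4) x =
      a * ((x : ℝ) ^ 2 + n) - b * ((x : ℝ) ^ 4 + 6 * n * (x : ℝ) ^ 2 + 3 * n ^ 2 - 2 * n) := by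
  induction n generalizing x with
  | zero => simp
  | succ n ih => simp only [Function.iterate_succ_apply', stepAvg, ih]; push_cast; ring

/-- The mean absolute value of `n` steps of simple random walk started at `0`. -/
def walkMeanAbs (n : ℕ) : ℝ := stepAvg^[n] (fun y => |(y : ℝ)|) 0

theorem walkMeanAbs_nonneg (n : ℕ) : 0 ≤ walkMeanAbs n := by
  rw [← stepAvg_iterate_const 0 n 0]
  exact stepAvg_iterate_mono (fun x => abs_nonneg _) n 0

theorem walkMeanAbs_le (n : ℕ) : walkMeanAbs n ≤ n := by
  have : ∀ (x : ℤ), stepAvg^[n] (fun y => |(y : ℝ)|) x ≤ |(x : ℝ)| + n := by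
    induction n with
    | zero => simp
    | succ n ih =>
      intro x
      simp only [Function.iterate_succ_apply', stepAvg]
      have h1 := ih (x + 1)
      have h2 := ih (x - 1)
      push_cast at h1 h2 ⊢
      have h3 := abs_add_le (x : ℝ) 1
      have h4 := abs_sub (x : ℝ) 1
      rw [abs_one] at h3 h4
      linarith
  simpa [walkMeanAbs] using this 0

/-- Fourth moment method: `z - z³ ≤ 1` for `z = |y| / (3√m)` bounds `|y|` below by a combination of
`y²` and `y⁴`, whose walk averages are explicit. The main terms give 1/3 - 1/9 = 2/9. -/
theorem le_walkMeanAbs {m : ℕ} (hm : 1 ≤ m) : 2 / 9 * √(m : ℝ) ≤ walkMeanAbs m := by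
  have hm' : (0 : ℝ) < m := by exact_mod_cast hm
  set s := √(m : ℝ) with hs
  have hs0 : 0 < s := Real.sqrt_pos.2 hm'
  have hs2 : (m : ℝ) = s ^ 2 := (Real.sq_sqrt hm'.le).symm
  have key : ∀ y : ℤ, 1 / (3 * s) * (y : ℝ) ^ 2 - 1 / (3 * s) ^ 3 * (y : ℝ) ^ 4 ≤ |(y : ℝ)| := by
    intro y
    have e : 1 / (3 * s) * (y : ℝ) ^ 2 - 1 / (3 * s) ^ 3 * (y : ℝ) ^ 4 =
        |(y : ℝ)| * (|(y : ℝ)| / (3 * s) - (|(y : ℝ)| / (3 * s)) ^ 3) := by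
      rw [← sq_abs, show (y : ℝ) ^ 4 = |(y : ℝ)| ^ 4 from (Even.pow_abs (by decide) _).symm]
      field_simp
    rw [e]
    refine mul_le_of_le_one_right (abs_nonneg _) ?_
    have : 0 ≤ |(y : ℝ)| / (3 * s) := by positivity
    generalize |(y : ℝ)| / (3 * s) = z at this
    nlinarith [mul_nonneg this (sq_nonneg (z - 1)), sq_nonneg (z - 1)]
  have h := stepAvg_iterate_mono key m 0
  rw [stepAvg_iterate_sq_sub_pow_four] at h
  refine le_trans ?_ h
  rw [hs2]
  have : 1 / (3 * s) * (((0 : ℤ) : ℝ) ^ 2 + s ^ 2) - 1 / (3 * s) ^ 3 * (((0 : ℤ) : ℝ) ^ 4 +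
      6 * s ^ 2 * ((0 : ℤ) : ℝ) ^ 2 + 3 * (s ^ 2) ^ 2 - 2 * s ^ 2) =
      2 / 9 * s + 2 / (27 * s) := by
    push_cast
    field_simp
    ring
  rw [this]
  have : 0 < 2 / (27 * s) := by positivity
  linarith

/-! ### The binomial mean deviation in closed form -/

theorem binomialMeanDeviation_eq_sum (m : ℕ) :
    binomialMeanDeviation m =
      (∑ k ∈ Finset.range (m + 1), (m.choose k : ℝ) * |(k : ℝ) - m / 2|) / 2 ^ m := by
  rw [binomialMeanDeviation, ProbabilityTheory.integral_binomial, Finset.sum_div]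
  refine Finset.sum_congr (by ext; simp) fun k hk => ?_
  have hk : k ≤ m := by simpa using hk
  have : (1 / 2 : ℝ) ^ k * (1 - 1 / 2) ^ (m - k) = 1 / 2 ^ m := by
    rw [show (1 - 1 / 2 : ℝ) = 1 / 2 by norm_num, ← pow_add, Nat.add_sub_cancel' hk, one_div_pow]
  simp only [smul_eq_mul]
  rw [mul_assoc (m.choose k : ℝ), this]
  ring

theorem walkMeanAbs_eq (m : ℕ) : walkMeanAbs m = 2 * binomialMeanDeviation m := by
  rw [walkMeanAbs, stepAvg_iterate_apply, binomialMeanDeviation_eq_sum, Finset.sum_div,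
    Finset.mul_sum]
  refine Finset.sum_congr rfl fun k _ => ?_
  have : |(((0 : ℤ) + 2 * k - m : ℤ) : ℝ)| = 2 * |(k : ℝ) - m / 2| := by
    rw [← abs_of_pos (two_pos (α := ℝ)), ← abs_mul, abs_of_pos (two_pos (α := ℝ))]
    congr 1
    push_cast
    ring
  rw [this]
  ring

/-- The central term vanishes, and the reflection `k ↦ 2p - k` matches the lower half of the sum
with the upper half. -/
theorem sum_choose_mul_abs_even (p : ℕ) :
    ∑ k ∈ Finset.range (2 * p + 1), ((2 * p).choose k : ℝ) * |(k : ℝ) - p| =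
      2 * ∑ i ∈ Finset.Icc 1 p, (i : ℝ) * ((2 * p).choose (p + i) : ℝ) := by
  have hI : ∑ i ∈ Finset.Icc 1 p, (i : ℝ) * ((2 * p).choose (p + i) : ℝ) =
      ∑ i ∈ Finset.range p, ((i : ℝ) + 1) * ((2 * p).choose (p + (i + 1)) : ℝ) := by
    rw [← Finset.Ico_add_one_right_eq_Icc, Finset.sum_Ico_eq_sum_range]
    simp only [Nat.add_sub_cancel]
    refine Finset.sum_congr rfl fun i _ => ?_
    push_cast
    rw [show p + (1 + i) = p + (i + 1) by ring]
    ring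
  rw [hI, show 2 * p + 1 = p + (1 + p) by ring, Finset.sum_range_add, Finset.sum_range_add,
    ← Finset.sum_range_reflect]
  simp only [Finset.sum_range_one, Nat.cast_add, two_mul]
  have h1 : ∀ i ∈ Finset.range p, ((p + p).choose (p - 1 - i) : ℝ) * |((p - 1 - i : ℕ) : ℝ) - p| =
      ((i : ℝ) + 1) * ((p + p).choose (p + (i + 1)) : ℝ) := by
    intro i hi
    have hi : i < p := by simpa using hi
    rw [← Nat.choose_symm (by omega : p - 1 - i ≤ p + p),
      show p + p - (p - 1 - i) = p + (i + 1) by omega, Nat.sub_sub, Nat.cast_sub (by omega)]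
    push_cast
    rw [abs_of_nonpos (by linarith [Nat.cast_nonneg (α := ℝ) i])]
    ring
  have h2 : ∀ i ∈ Finset.range p, ((p + p).choose (p + (1 + i)) : ℝ) *
      |(p : ℝ) + (((1 : ℕ) : ℝ) + (i : ℝ)) - p| =
      ((i : ℝ) + 1) * ((p + p).choose (p + (i + 1)) : ℝ) := by
    intro i _
    rw [add_sub_cancel_left, abs_of_nonneg (by positivity), show 1 + i = i + 1 by ring]
    push_cast
    ring
  rw [Finset.sum_congr rfl h1, Finset.sum_congr rfl h2]
  simp

theorem sum_choose_mul_abs_odd (p : ℕ) :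
    ∑ k ∈ Finset.range (2 * p + 1 + 1), ((2 * p + 1).choose k : ℝ) *
        |(k : ℝ) - (2 * p + 1 : ℕ) / 2| =
      2 * ∑ i ∈ Finset.Icc 1 (p + 1), ((i : ℝ) - 1 / 2) * ((2 * p + 1).choose (p + i) : ℝ) := by
  have hI : ∑ i ∈ Finset.Icc 1 (p + 1), ((i : ℝ) - 1 / 2) * ((2 * p + 1).choose (p + i) : ℝ) =
      ∑ i ∈ Finset.range (p + 1), ((i : ℝ) + 1 / 2) * ((2 * p + 1).choose (p + 1 + i) : ℝ) := by
    rw [← Finset.Ico_add_one_right_eq_Icc, Finset.sum_Ico_eq_sum_range]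
    simp only [Nat.add_sub_cancel]
    refine Finset.sum_congr rfl fun i _ => ?_
    rw [show p + (1 + i) = p + 1 + i by ring]
    push_cast
    ring
  rw [hI, show 2 * p + 1 + 1 = (p + 1) + (p + 1) by ring, Finset.sum_range_add,
    ← Finset.sum_range_reflect]
  have h1 : ∀ i ∈ Finset.range (p + 1), ((2 * p + 1).choose (p + 1 - 1 - i) : ℝ) *
      |((p + 1 - 1 - i : ℕ) : ℝ) - (2 * p + 1 : ℕ) / 2| =
      ((i : ℝ) + 1 / 2) * ((2 * p + 1).choose (p + 1 + i) : ℝ) := by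
    intro i hi
    have hi : i < p + 1 := by simpa using hi
    rw [← Nat.choose_symm (by omega : p + 1 - 1 - i ≤ 2 * p + 1),
      show 2 * p + 1 - (p + 1 - 1 - i) = p + 1 + i by omega, Nat.add_sub_cancel,
      Nat.cast_sub (by omega)]
    push_cast
    rw [abs_of_nonpos (by linarith [Nat.cast_nonneg (α := ℝ) i])]
    ring
  have h2 : ∀ i ∈ Finset.range (p + 1), ((2 * p + 1).choose (p + 1 + i) : ℝ) *
      |((p + 1 + i : ℕ) : ℝ) - (2 * p + 1 : ℕ) / 2| =
      ((i : ℝ) + 1 / 2) * ((2 * p + 1).choose (p + 1 + i) : ℝ) := by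
    intro i _
    push_cast
    rw [abs_of_nonneg (by linarith [Nat.cast_nonneg (α := ℝ) i])]
    ring
  rw [Finset.sum_congr rfl h1, Finset.sum_congr rfl h2]
  ring

theorem binomialMeanDeviation_div_eq_explicitBound (m : ℕ) :
    binomialMeanDeviation m / m = explicitBound m := by
  have h2 : (2 : ℝ) ^ (1 - (m : ℤ)) = 2 / 2 ^ m := by
    rw [zpow_sub₀ two_ne_zero, zpow_one, zpow_natCast]
  rw [binomialMeanDeviation_eq_sum, explicitBound, h2]
  split_ifs with h
  · obtain ⟨p, hp⟩ := h.two_dvd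
    subst hp
    have : ((2 * p : ℕ) : ℝ) / 2 = p := by push_cast; ring
    rw [this, sum_choose_mul_abs_even, Nat.mul_div_cancel_left p two_pos]
    ring
  · obtain ⟨p, hp⟩ := Nat.not_even_iff_odd.1 h
    subst hp
    rw [sum_choose_mul_abs_odd, show (2 * p + 1 - 1) / 2 = p by omega,
      show (2 * p + 1 + 1) / 2 = p + 1 by omega]
    ring

/-! ### Two-colourings and modularity -/

namespace Multigraph

section Colouring

variable {V W E : Type*} [Fintype E]

/-- The sum over all edges of the sum of the labels of the two endpoints. -/
def edgeSum (G : Multigraph V E) (h : V → ℤ) : ℤ := ∑ e, ((G.ends e).map h).add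

/-- The sum over all edges of the product of the labels of the two endpoints. -/
def edgeProd (G : Multigraph V E) (h : V → ℤ) : ℤ := ∑ e, ((G.ends e).map h).mul

theorem edgeSum_mapVertices (f : V → W) (G : Multigraph V E) (h : W → ℤ) :
    (G.mapVertices f).edgeSum h = G.edgeSum (h ∘ f) := by
  simp [edgeSum, mapVertices, Sym2.map_map]

theorem edgeProd_mapVertices (f : V → W) (G : Multigraph V E) (h : W → ℤ) :
    (G.mapVertices f).edgeProd h = G.edgeProd (h ∘ f) := by
  simp [edgeProd, mapVertices, Sym2.map_map]

variable [Fintype V] [DecidableEq V]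

theorem sum_deg_mul (G : Multigraph V E) (h : V → ℤ) :
    ∑ v, (G.deg v : ℤ) * h v = G.edgeSum h := by
  simp only [deg, edgeSum, Nat.cast_sum, Finset.sum_mul]
  rw [Finset.sum_comm]
  refine Finset.sum_congr rfl fun e _ => ?_
  induction G.ends e with
  | _ a b =>
    have : ∀ v, ((s(a, b).toMultiset.count v : ℕ) : ℤ) * h v =
        (if v = a then h v else 0) + if v = b then h v else 0 := by
      intro v
      have : s(a, b).toMultiset = a ::ₘ b ::ₘ 0 := rfl
      rw [this]
      simp only [Multiset.count_cons, Multiset.count_zero]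
      split_ifs <;> simp [two_mul]
    simp [this, Finset.sum_add_distrib]

theorem edgesWithin_empty (G : Multigraph V E) : G.edgesWithin ∅ = 0 := by
  unfold edgesWithin
  rw [Finset.card_eq_zero, Finset.filter_eq_empty_iff]
  intro e _ h
  induction he : G.ends e with
  | _ a b => exact absurd (h a (by rw [he]; exact Sym2.mem_mk_left a b)) (Finset.notMem_empty a)

/-- A two-colouring of the vertices gives a lower bound for the modularity. -/
theorem le_modularity_of_colouring (G : Multigraph V E) (hE : 0 < Fintype.card E) (χ : V → ℤ)
    (hχ : ∀ v, χ v = 1 ∨ χ v = -1) :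
    (G.edgeProd χ : ℝ) / (2 * Fintype.card E) -
      (G.edgeSum χ : ℝ) ^ 2 / (8 * (Fintype.card E : ℝ) ^ 2) ≤ G.modularity := by
  set A : Finset V := Finset.univ.filter fun v => χ v = 1 with hA
  set B : Finset V := Finset.univ.filter fun v => χ v = -1 with hB
  set f : Finset V → ℝ := fun A => (G.edgesWithin A : ℝ) / (Fintype.card E : ℝ)
      - (∑ v ∈ A, (G.deg v : ℝ)) ^ 2 / (4 * (Fintype.card E : ℝ) ^ 2) with hf
  have hdisj : Disjoint A B := by
    rw [Finset.disjoint_filter]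
    intro v _ h1 h2
    omega
  -- Equal disjoint classes would both be empty, but an edge supplies a vertex.
  have hne : A ≠ B := by
    intro h
    have hA0 : A = ∅ := by rw [h] at hdisj ⊢; exact disjoint_self.1 hdisj
    obtain ⟨e⟩ := Fintype.card_pos_iff.1 hE
    induction G.ends e with
    | _ a b =>
      rcases hχ a with ha | ha
      · have : a ∈ A := by simp [hA, ha]
        simp [hA0] at this
      · have : a ∈ B := by simp [hB, ha]
        rw [← h, hA0] at this
        simp at this
  let P : Finpartition (Finset.univ : Finset V) := Finpartition.ofErase {A, B}
    (by rw [Finset.supIndep_pair hne]; exact hdisj)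
    (by
      ext v
      rcases hχ v with h | h <;> simp [hA, hB, h])
  refine le_trans ?_ (Finset.le_sup' G.partitionModularity (Finset.mem_univ P))
  -- In a monochromatic colouring one class is empty and is erased from the partition; this is
  -- harmless because `f ∅ = 0`.
  have hP : G.partitionModularity P = f A + f B := by
    change ∑ C ∈ ({A, B} : Finset (Finset V)).erase ⊥, f C = _
    rw [Finset.sum_erase, Finset.sum_pair hne]
    simp [hf, edgesWithin_empty]
  have hedges : (2 * (G.edgesWithin A + G.edgesWithin B) : ℤ) = Fintype.card E + G.edgeProd χ := by
    simp only [edgesWithin, Finset.card_filter, edgeProd, Fintype.card_eq_sum_ones, Nat.cast_sum]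
    rw [← Finset.sum_add_distrib, ← Finset.sum_add_distrib, Finset.mul_sum]
    refine Finset.sum_congr rfl fun e _ => ?_
    induction G.ends e with
    | _ a b =>
      rcases hχ a with ha | ha <;> rcases hχ b with hb | hb <;> simp [hA, hB, ha, hb]
  have hvolA : (2 * ∑ v ∈ A, (G.deg v : ℤ)) = 2 * Fintype.card E + G.edgeSum χ := by
    have := G.sum_deg
    rw [← sum_deg_mul, ← Nat.cast_two, ← Nat.cast_mul, ← this, Nat.cast_sum,
      ← Finset.sum_add_distrib, hA, Finset.sum_filter, Nat.cast_two, Finset.mul_sum]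
    refine Finset.sum_congr rfl fun v _ => ?_
    rcases hχ v with h | h <;> simp [h, two_mul]
  have hvolB : (2 * ∑ v ∈ B, (G.deg v : ℤ)) = 2 * Fintype.card E - G.edgeSum χ := by
    have := G.sum_deg
    rw [← sum_deg_mul, ← Nat.cast_two, ← Nat.cast_mul, ← this, Nat.cast_sum,
      ← Finset.sum_sub_distrib, hB, Finset.sum_filter, Nat.cast_two, Finset.mul_sum]
    refine Finset.sum_congr rfl fun v _ => ?_
    rcases hχ v with h | h <;> simp [h, two_mul]
  have hM : (0 : ℝ) < Fintype.card E := by exact_mod_cast hE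
  rw [hP]
  simp only [hf]
  have e1 : (G.edgesWithin B : ℝ) = (Fintype.card E + G.edgeProd χ) / 2 - G.edgesWithin A := by
    have : (2 * (G.edgesWithin A + G.edgesWithin B) : ℝ) = Fintype.card E + G.edgeProd χ := by
      exact_mod_cast hedges
    linarith
  have e2 : ∑ v ∈ A, (G.deg v : ℝ) = Fintype.card E + (G.edgeSum χ : ℝ) / 2 := by
    have : (2 * ∑ v ∈ A, (G.deg v : ℝ)) = 2 * Fintype.card E + G.edgeSum χ := by
      exact_mod_cast hvolA
    linarith
  have e3 : ∑ v ∈ B, (G.deg v : ℝ) = Fintype.card E - (G.edgeSum χ : ℝ) / 2 := by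
    have : (2 * ∑ v ∈ B, (G.deg v : ℝ)) = 2 * Fintype.card E - G.edgeSum χ := by
      exact_mod_cast hvolB
    linarith
  rw [e1, e2, e3]
  refine le_of_eq ?_
  field_simp
  ring

end Colouring

theorem edgeSum_addVertex {t : ℕ} (G : Multigraph (Fin t) (Fin t)) (i : Fin (t + 1))
    (h : Fin (t + 1) → ℤ) :
    (G.addVertex i).edgeSum h = G.edgeSum (h ∘ Fin.castSucc) + (h (Fin.last t) + h i) := by
  simp [edgeSum, addVertex, Fin.sum_univ_castSucc, Sym2.map_map]

theorem edgeProd_addVertex {t : ℕ} (G : Multigraph (Fin t) (Fin t)) (i : Fin (t + 1))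
    (h : Fin (t + 1) → ℤ) :
    (G.addVertex i).edgeProd h = G.edgeProd (h ∘ Fin.castSucc) + h (Fin.last t) * h i := by
  simp [edgeProd, addVertex, Fin.sum_univ_castSucc, Sym2.map_map]

end Multigraph

/-! ### The online colouring and its invariants -/

/-- The colour given to a completed block of vertices: the sign of the balance `x` of the colours
of its targets if the index `k` of the block is at least `k₀` (ties being broken by `κ`), and the
default colour `κ` otherwise. -/
def blockSign (k₀ k : ℕ) (κ x : ℤ) : ℤ := if k₀ ≤ k ∧ x ≠ 0 then x.sign else κ

theorem blockSign_eq_or {k₀ k : ℕ} {κ x : ℤ} (hκ : κ = 1 ∨ κ = -1) :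
    blockSign k₀ k κ x = 1 ∨ blockSign k₀ k κ x = -1 := by
  unfold blockSign
  split_ifs with h
  · rcases lt_or_gt_of_ne h.2 with h | h
    · exact Or.inr (Int.sign_eq_neg_one_of_neg h)
    · exact Or.inl (Int.sign_eq_one_of_pos h)
  · exact hκ

/-- A preferential attachment multigraph together with the state of an online two-colouring of the
blocks of vertices. -/
structure ColouringState (t : ℕ) where
  /-- the multigraph -/
  graph : Multigraph (Fin t) (Fin t)
  /-- the colours of the blocks -/
  colour : ℕ → ℤ
  /-- the number of completed blocks -/
  block : ℕ
  /-- the number of vertices in the current block -/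
  pos : ℕ
  /-- the sum of the colours of the targets of the edges of the current block -/
  balance : ℤ
  /-- the number of edges inside the current block -/
  loops : ℤ
  /-- the default colour of the current block -/
  default : ℤ
  /-- the sum of the degrees of the coloured vertices, weighted by their colours -/
  bias : ℤ
  /-- the sum, over the edges between coloured vertices, of the product of the two colours -/
  gain : ℤ

namespace ColouringState

variable {t : ℕ}

/-- The colour of the target `i` of the next edge; it is `0` for a target in the current block. -/
def targetColour (m : ℕ) (s : ColouringState t) (i : Fin (t + 1)) : ℤ :=
  Function.update s.colour s.block 0 (i / m)

/-- Add a new vertex joined to `i`. -/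
def push (m : ℕ) (s : ColouringState t) (i : Fin (t + 1)) : ColouringState (t + 1) where
  graph := s.graph.addVertex i
  colour := s.colour
  block := s.block
  pos := s.pos + 1
  balance := s.balance + s.targetColour m i
  loops := s.loops + (1 - s.targetColour m i ^ 2)
  default := s.default
  bias := s.bias + s.targetColour m i
  gain := s.gain

/-- The colour that the current block receives when it is completed. -/
def nextColour (k₀ : ℕ) (s : ColouringState t) : ℤ :=
  blockSign k₀ s.block s.default s.balance

/-- The bias after colouring the current block of `m` vertices. -/
def nextBias (m k₀ : ℕ) (s : ColouringState t) : ℤ :=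
  s.bias + (m + s.loops) * s.nextColour k₀

/-- Colour the current block and start a new one. -/
def commit (m k₀ : ℕ) (s : ColouringState t) : ColouringState t where
  graph := s.graph
  colour := Function.update s.colour s.block (s.nextColour k₀)
  block := s.block + 1
  pos := 0
  balance := 0
  loops := 0
  default := if s.nextBias m k₀ ≤ 0 then 1 else -1
  bias := s.nextBias m k₀
  gain := s.gain + s.loops + s.balance * s.nextColour k₀

/-- One step of the process: add a vertex, and colour the current block if it is complete. -/
def next (m k₀ : ℕ) (s : ColouringState t) (i : Fin (t + 1)) : ColouringState (t + 1) :=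
  if s.pos + 1 = m then (s.push m i).commit m k₀ else s.push m i

/-- The state before any vertex is added. -/
def init : ColouringState 0 := ⟨⟨Fin.elim0⟩, 0, 0, 0, 0, 0, 1, 0, 0⟩

/-- The relations between the data of a state. -/
structure Consistent (m : ℕ) (s : ColouringState t) : Prop where
  time : t = s.block * m + s.pos
  loops_nonneg : 0 ≤ s.loops
  loops_le : s.loops ≤ s.pos
  abs_balance_le : |s.balance| ≤ s.pos
  default_eq : s.default = 1 ∨ s.default = -1
  colour_eq : ∀ b < s.block, s.colour b = 1 ∨ s.colour b = -1
  -- The colour `y` of the current block is still undecided, so both identities are kept as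
  -- polynomials in `y`. Evaluation at 0 and 1 recovers degree sums, and evaluation at the chosen
  -- colour updates the state at a commit.
  edgeSum_eq : ∀ y, s.graph.edgeSum (fun v => Function.update s.colour s.block y (v / m)) =
    s.bias + (s.pos + s.loops) * y
  edgeProd_eq : ∀ y, s.graph.edgeProd (fun v => Function.update s.colour s.block y (v / m)) =
    s.gain + s.balance * y + s.loops * y ^ 2

variable {m k₀ : ℕ} {s : ColouringState t}

theorem Consistent.div_le (h : s.Consistent m) (hpos : s.pos < m) (i : Fin (t + 1)) :
    (i : ℕ) / m ≤ s.block := by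
  have hm : 0 < m := by omega
  have h1 : (i : ℕ) ≤ s.block * m + s.pos := by have := i.2; have := h.time; omega
  calc (i : ℕ) / m ≤ (s.block * m + s.pos) / m := Nat.div_le_div_right h1
    _ = s.block := by
      rw [mul_comm, Nat.mul_add_div hm, Nat.div_eq_of_lt hpos, add_zero]

theorem Consistent.targetColour_eq (h : s.Consistent m) (hpos : s.pos < m) (i : Fin (t + 1)) :
    s.targetColour m i = 0 ∨ s.targetColour m i = 1 ∨ s.targetColour m i = -1 := by
  unfold targetColour
  rcases eq_or_ne ((i : ℕ) / m) s.block with hi | hi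
  · left; rw [hi, Function.update_self]
  · right
    rw [Function.update_of_ne hi]
    exact h.colour_eq _ (lt_of_le_of_ne (h.div_le hpos i) hi)

/-- As target colours lie in {0, 1, -1}, the factor `1 - c²` is the indicator that the target lies
in the current block; the case split becomes polynomial algebra. -/
theorem Consistent.update_eq (h : s.Consistent m) (hpos : s.pos < m) (i : Fin (t + 1)) (y : ℤ) :
    Function.update s.colour s.block y (i / m) =
      s.targetColour m i + (1 - s.targetColour m i ^ 2) * y := by
  unfold targetColour
  rcases eq_or_ne ((i : ℕ) / m) s.block with hi | hi
  · simp [hi]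
  · rw [Function.update_of_ne hi, Function.update_of_ne hi]
    rcases h.colour_eq _ (lt_of_le_of_ne (h.div_le hpos i) hi) with h | h <;> simp [h]

theorem Consistent.targetColour_last (h : s.Consistent m) (hpos : s.pos < m) :
    s.targetColour m (Fin.last t) = 0 := by
  have hm : 0 < m := by omega
  have : (t : ℕ) / m = s.block := by
    conv_lhs => rw [h.time]
    rw [mul_comm, Nat.mul_add_div hm, Nat.div_eq_of_lt hpos, add_zero]
  simp [targetColour, this]

theorem Consistent.push (h : s.Consistent m) (hpos : s.pos < m) (i : Fin (t + 1)) :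
    (s.push m i).Consistent m := by
  have hlast : ∀ y, Function.update s.colour s.block y ((Fin.last t : Fin (t + 1)) / m) = y := by
    intro y
    rw [h.update_eq hpos, h.targetColour_last hpos]
    ring
  refine ⟨?_, ?_, ?_, ?_, h.default_eq, h.colour_eq, ?_, ?_⟩
  · have := h.time
    simp only [ColouringState.push]
    omega
  · have := h.loops_nonneg
    rcases h.targetColour_eq hpos i with hc | hc | hc <;> simp [ColouringState.push, hc] <;> omega
  · have := h.loops_le
    rcases h.targetColour_eq hpos i with hc | hc | hc <;> simp [ColouringState.push, hc] <;> omega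
  · have := abs_le.1 h.abs_balance_le
    rcases h.targetColour_eq hpos i with hc | hc | hc <;>
      simp only [ColouringState.push, hc, abs_le] <;> push_cast <;> constructor <;> linarith
  · intro y
    simp only [ColouringState.push]
    rw [edgeSum_addVertex, hlast, h.update_eq hpos]
    have := h.edgeSum_eq y
    simp only [Function.comp_def, Fin.val_castSucc, this]
    push_cast
    ring
  · intro y
    simp only [ColouringState.push]
    rw [edgeProd_addVertex, hlast, h.update_eq hpos]
    have := h.edgeProd_eq y
    simp only [Function.comp_def, Fin.val_castSucc, this]
    ring

theorem Consistent.commit (h : s.Consistent m) (hpos : s.pos = m) :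
    (s.commit m k₀).Consistent m := by
  have hs : s.nextColour k₀ = 1 ∨ s.nextColour k₀ = -1 := blockSign_eq_or h.default_eq
  have hcol : ∀ y : ℤ, (fun v : Fin t => Function.update (s.commit m k₀).colour
      (s.commit m k₀).block y (v / m)) =
      fun v : Fin t => Function.update s.colour s.block (s.nextColour k₀) (v / m) := by
    intro y
    ext v
    have : (v : ℕ) / m ≠ s.block + 1 := by
      refine (Nat.div_lt_of_lt_mul ?_).ne
      have := v.2
      have := h.time
      rw [mul_comm, add_mul]
      omega
    simp only [ColouringState.commit]
    rw [Function.update_of_ne this]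
  refine ⟨?_, le_rfl, by simp [ColouringState.commit], by simp [ColouringState.commit], ?_, ?_,
    ?_, ?_⟩
  · have := h.time
    simp only [ColouringState.commit, add_mul]
    omega
  · simp only [ColouringState.commit]
    split_ifs <;> simp
  · intro b hb
    simp only [ColouringState.commit] at hb ⊢
    rcases eq_or_ne b s.block with hb' | hb'
    · rwa [hb', Function.update_self]
    · rw [Function.update_of_ne hb']
      exact h.colour_eq b (by omega)
  · intro y
    rw [hcol]
    have := h.edgeSum_eq (s.nextColour k₀)
    rw [show (s.commit m k₀).graph = s.graph from rfl, this]
    simp [ColouringState.commit, nextBias, hpos]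
  · intro y
    rw [hcol]
    have := h.edgeProd_eq (s.nextColour k₀)
    rw [show (s.commit m k₀).graph = s.graph from rfl, this]
    rcases hs with hs | hs <;> simp [ColouringState.commit, hs] <;> ring

theorem Consistent.next (h : s.Consistent m) (hpos : s.pos < m) (i : Fin (t + 1)) :
    (s.next m k₀ i).Consistent m ∧ (s.next m k₀ i).pos < m := by
  unfold ColouringState.next
  split_ifs with hm
  · exact ⟨(h.push hpos i).commit hm, by simp only [ColouringState.commit]; omega⟩
  · exact ⟨h.push hpos i, by simp only [ColouringState.push]; omega⟩

theorem consistent_init (m : ℕ) : init.Consistent m := by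
  refine ⟨by simp [init], by simp [init], by simp [init], by simp [init], by simp [init],
    by simp [init], ?_, ?_⟩ <;> simp [init, edgeSum, edgeProd]

theorem graph_next (i : Fin (t + 1)) : (s.next m k₀ i).graph = s.graph.addVertex i := by
  unfold ColouringState.next
  split_ifs <;> rfl

/-- The expected colour of the next target. -/
theorem Consistent.sum_attachProb_mul_targetColour (h : s.Consistent m) (hpos : s.pos < m) :
    ∑ i, (s.graph.attachProb i).toReal * (s.targetColour m i : ℝ) =
      (s.bias : ℝ) / (2 * t + 1) := by
  have h0 := h.edgeSum_eq 0
  rw [← sum_deg_mul, mul_zero, add_zero] at h0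
  rw [Fin.sum_univ_castSucc, h.targetColour_last hpos, ← h0, Int.cast_sum, Finset.sum_div,
    Int.cast_zero, mul_zero, add_zero]
  refine Finset.sum_congr rfl fun v _ => ?_
  have e : (((s.graph.deg v : ℝ≥0∞) / (2 * t + 1)).toReal : ℝ) = s.graph.deg v / (2 * t + 1) := by
    rw [ENNReal.toReal_div, ENNReal.toReal_natCast]
    congr 1
  simp only [attachProb, Fin.snoc_castSucc, e, targetColour, Fin.val_castSucc]
  push_cast
  ring

/-- The probability that the next target lies in the current block. -/
theorem Consistent.sum_attachProb_mul_one_sub_sq (h : s.Consistent m) (hpos : s.pos < m) :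
    ∑ i, (s.graph.attachProb i).toReal * (1 - (s.targetColour m i : ℝ) ^ 2) =
      (s.pos + s.loops + 1 : ℝ) / (2 * t + 1) := by
  have h0 := h.edgeSum_eq 0
  have h1 := h.edgeSum_eq 1
  have hd : ((s.pos + s.loops : ℤ) : ℝ) = ∑ v : Fin t, (s.graph.deg v : ℝ) *
      (1 - (s.targetColour m v.castSucc : ℝ) ^ 2) := by
    -- The total degree of the current block is the difference of `edgeSum_eq` at 1 and at 0. The
    -- new vertex itself contributes the remaining `+ 1` of the numerator.
    rw [show (s.pos + s.loops : ℤ) = (s.bias + (s.pos + s.loops) * 1) -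
      (s.bias + (s.pos + s.loops) * 0) by ring, ← h0, ← h1, ← sum_deg_mul, ← sum_deg_mul,
      ← Finset.sum_sub_distrib, Int.cast_sum]
    refine Finset.sum_congr rfl fun v _ => ?_
    have e1 := h.update_eq hpos v.castSucc 1
    have e0 := h.update_eq hpos v.castSucc 0
    rw [Fin.val_castSucc] at e1 e0
    rw [e1, e0]
    push_cast
    ring
  rw [Fin.sum_univ_castSucc, h.targetColour_last hpos, add_div]
  have e : ∀ x : ℝ≥0∞, (x / (2 * t + 1)).toReal = x.toReal / (2 * t + 1) := by
    intro x
    rw [ENNReal.toReal_div]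
    congr 1
  congr 1
  · push_cast at hd
    rw [hd, Finset.sum_div]
    refine Finset.sum_congr rfl fun v _ => ?_
    simp only [attachProb, Fin.snoc_castSucc, e, ENNReal.toReal_natCast]
    ring
  · simp only [attachProb, Fin.snoc_last, e]
    norm_num

end ColouringState

open ColouringState

/-! ### Coupling with the attachment process -/

/-- The joint law of the preferential attachment multigraph and its online colouring. -/
def colouringLaw (m k₀ : ℕ) : (t : ℕ) → PMF (ColouringState t)
  | 0 => PMF.pure init
  | t + 1 => (colouringLaw m k₀ t).bind fun s => s.graph.attach.map (s.next m k₀)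

/-- The colouring only records the history and never influences the choice of targets. -/
theorem map_graph_colouringLaw (m k₀ t : ℕ) :
    (colouringLaw m k₀ t).map ColouringState.graph = prefAttachOne t := by
  induction t with
  | zero => simp [colouringLaw, prefAttachOne, PMF.pure_map, init]
  | succ t ih =>
    rw [colouringLaw, prefAttachOne, PMF.map_bind, ← ih, PMF.bind_map]
    congr 1
    funext s
    rw [PMF.map_comp]
    congr 1
    funext i
    exact graph_next i

theorem consistent_of_mem_support {m : ℕ} (hm : 1 ≤ m) (k₀ : ℕ) {t : ℕ} {s : ColouringState t}
    (hs : s ∈ (colouringLaw m k₀ t).support) : s.Consistent m ∧ s.pos < m := by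
  induction t with
  | zero =>
    rw [colouringLaw, PMF.mem_support_pure_iff] at hs
    subst hs
    exact ⟨consistent_init m, hm⟩
  | succ t ih =>
    rw [colouringLaw, PMF.mem_support_bind_iff] at hs
    obtain ⟨s', hs', hs⟩ := hs
    rw [PMF.mem_support_map_iff] at hs
    obtain ⟨i, _, rfl⟩ := hs
    obtain ⟨h1, h2⟩ := ih hs'
    exact h1.next h2 i

/-! ### One-step second moment estimates -/

/-- Here `b` is the mean of `h` under a fair sign. On {0, 1, -1}, `h c - b` equals `(h 1 - h (-1))/2
* c + (h 0 - b) * (1 - c²)`, so the true mean deviates from `b` only through the unfairness `δ` and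
the mass `ρ` at 0. Expanding `h² = b² + 2b(h - b) + (h - b)²` gives the bound. -/
theorem sum_mul_sq_le {ι : Type*} [Fintype ι] {w : ι → ℝ} {c : ι → ℤ} {h : ℤ → ℝ}
    {a b B δ ρ : ℝ} (hw : ∀ i, 0 ≤ w i) (hw1 : ∑ i, w i = 1)
    (hc : ∀ i, c i = 0 ∨ c i = 1 ∨ c i = -1) (hδ : ∑ i, w i * (c i : ℝ) = δ)
    (hρ : ∑ i, w i * (1 - (c i : ℝ) ^ 2) = ρ) (hb : b = (h 1 + h (-1)) / 2)
    (ha : |(h 1 - h (-1)) / 2| ≤ a) (hB : ∀ j : ℤ, j = 0 ∨ j = 1 ∨ j = -1 → |h j - b| ≤ B) :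
    ∑ i, w i * h (c i) ^ 2 ≤ b ^ 2 + 2 * |b| * (a * |δ| + B * ρ) + B ^ 2 := by
  have hB0 : 0 ≤ B := (abs_nonneg _).trans (hB 0 (Or.inl rfl))
  have hρ0 : 0 ≤ ρ := by
    rw [← hρ]
    refine Finset.sum_nonneg fun i _ => mul_nonneg (hw i) ?_
    rcases hc i with h | h | h <;> simp [h]
  have key : ∀ i, h (c i) ^ 2 ≤ (b ^ 2 + B ^ 2) + 2 * b * ((h 1 - h (-1)) / 2) * c i +
      2 * b * (h 0 - b) * (1 - (c i : ℝ) ^ 2) := by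
    intro i
    have h1 : (h (c i) - b) ^ 2 ≤ B ^ 2 := sq_le_sq' (abs_le.1 (hB _ (hc i))).1
      (abs_le.1 (hB _ (hc i))).2
    rcases hc i with h | h | h <;> rw [h] at h1 ⊢ <;> push_cast
    · nlinarith
    · subst hb; nlinarith
    · subst hb; nlinarith
  calc ∑ i, w i * h (c i) ^ 2
      ≤ ∑ i, w i * ((b ^ 2 + B ^ 2) + 2 * b * ((h 1 - h (-1)) / 2) * c i +
        2 * b * (h 0 - b) * (1 - (c i : ℝ) ^ 2)) :=
        Finset.sum_le_sum fun i _ => mul_le_mul_of_nonneg_left (key i) (hw i)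
    _ = (b ^ 2 + B ^ 2) * ∑ i, w i + 2 * b * ((h 1 - h (-1)) / 2) * ∑ i, w i * (c i : ℝ) +
        2 * b * (h 0 - b) * ∑ i, w i * (1 - (c i : ℝ) ^ 2) := by
        simp only [Finset.mul_sum, ← Finset.sum_add_distrib]
        exact Finset.sum_congr rfl fun i _ => by ring
    _ = b ^ 2 + 2 * (b * ((h 1 - h (-1)) / 2 * δ + (h 0 - b) * ρ)) + B ^ 2 := by
        rw [hw1, hδ, hρ]; ring
    _ ≤ b ^ 2 + 2 * |b| * (a * |δ| + B * ρ) + B ^ 2 := by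
        have : b * ((h 1 - h (-1)) / 2 * δ + (h 0 - b) * ρ) ≤ |b| * (a * |δ| + B * ρ) := by
          refine (le_abs_self _).trans ?_
          rw [abs_mul]
          refine mul_le_mul_of_nonneg_left ((abs_add_le _ _).trans ?_) (abs_nonneg _)
          rw [abs_mul, abs_mul, abs_of_nonneg hρ0]
          exact add_le_add (mul_le_mul_of_nonneg_right ha (abs_nonneg _))
            (mul_le_mul_of_nonneg_right (hB 0 (Or.inl rfl)) hρ0)
        linarith

/-- The colour of the block, as a real function of the balance. -/
def signFun (k₀ k : ℕ) (κ : ℤ) : ℤ → ℝ := fun x => blockSign k₀ k κ x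

/-- The contribution of the targets of a block to the gain, as a function of the balance. -/
def payFun (k₀ k : ℕ) (κ : ℤ) : ℤ → ℝ := fun x => x * blockSign k₀ k κ x

theorem payFun_of_le {k₀ k : ℕ} (h : k₀ ≤ k) (κ : ℤ) :
    payFun k₀ k κ = fun x : ℤ => |(x : ℝ)| := by
  ext x
  rcases eq_or_ne x 0 with hx | hx
  · simp [payFun, hx]
  · simp only [payFun, blockSign, h, hx, ne_eq, not_false_eq_true, and_self, if_true]
    rw [← Int.cast_mul, mul_comm, Int.sign_mul_self_eq_abs, Int.cast_abs]

theorem payFun_of_lt {k₀ k : ℕ} (h : k < k₀) (κ : ℤ) :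
    payFun k₀ k κ = fun x : ℤ => (κ : ℝ) * x := by
  ext x
  simp [payFun, blockSign, h.not_ge, mul_comm]

theorem signFun_of_lt {k₀ k : ℕ} (h : k < k₀) (κ : ℤ) :
    signFun k₀ k κ = fun _ => (κ : ℝ) := by
  ext x
  simp [signFun, blockSign, h.not_ge]

section Potential

variable {k₀ k : ℕ} {κ : ℤ}

theorem abs_signFun_le (hκ : κ = 1 ∨ κ = -1) (x : ℤ) : |signFun k₀ k κ x| ≤ 1 := by
  rcases blockSign_eq_or (k₀ := k₀) (k := k) (x := x) hκ with h | h <;> simp [signFun, h]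

theorem abs_payFun_succ_sub_le (hκ : κ = 1 ∨ κ = -1) (x : ℤ) :
    |payFun k₀ k κ (x + 1) - payFun k₀ k κ x| ≤ 1 := by
  rcases le_or_gt k₀ k with h | h
  · rw [payFun_of_le h]
    refine (abs_abs_sub_abs_le _ _).trans ?_
    push_cast
    simp
  · rw [payFun_of_lt h]
    rcases hκ with rfl | rfl <;> push_cast <;> ring_nf <;> simp

theorem signFun_add_neg_nonneg (hκ : κ = 1 ∨ κ = -1) (x : ℤ) :
    0 ≤ (κ : ℝ) * (signFun k₀ k κ x + signFun k₀ k κ (-x)) := by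
  unfold signFun blockSign
  by_cases h : k₀ ≤ k ∧ x ≠ 0
  · have h' : k₀ ≤ k ∧ -x ≠ 0 := by simpa using h
    rw [if_pos h, if_pos h']
    simp [Int.sign_neg]
  · have h' : ¬(k₀ ≤ k ∧ -x ≠ 0) := by simpa using h
    rw [if_neg h, if_neg h']
    rcases hκ with rfl | rfl <;> norm_num

theorem stepAvg_iterate_payFun_zero (m k₀ k : ℕ) (κ : ℤ) :
    stepAvg^[m] (payFun k₀ k κ) 0 = if k₀ ≤ k then walkMeanAbs m else 0 := by
  split_ifs with h
  · rw [payFun_of_le h, walkMeanAbs]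
  · rw [payFun_of_lt (not_le.1 h), stepAvg_iterate_linear]
    simp

namespace ColouringState

variable {t m : ℕ}

/-- The bias, corrected by the expected effect of colouring the current block. -/
def biasPot (m k₀ : ℕ) (s : ColouringState t) : ℝ :=
  s.bias + (m + s.loops) * stepAvg^[m - s.pos] (signFun k₀ s.block s.default) s.balance

/-- The gain, corrected by the expected contribution of the current block and centred. -/
def gainPot (m k₀ : ℕ) (s : ColouringState t) : ℝ :=
  s.gain + s.loops + stepAvg^[m - s.pos] (payFun k₀ s.block s.default) s.balance -
    walkMeanAbs m * ((s.block + 1 - k₀ : ℕ) : ℝ)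

/-- The potential whose expectation is controlled along the process. -/
def potential (m k₀ : ℕ) (s : ColouringState t) : ℝ := s.biasPot m k₀ ^ 2 + s.gainPot m k₀ ^ 2

theorem potential_nonneg (s : ColouringState t) : 0 ≤ s.potential m k₀ := by
  unfold potential; positivity

variable {s : ColouringState t}

/-- The gain potential is unchanged: a fresh block's expected pay is exactly its compensator. The
bias potential goes from `D` to `D + m * g` with `|g| ≤ 1`, and the new default colour opposes `D`,
so `D * g ≤ 0` and the square grows by at most `m²`. -/
theorem potential_commit_le (hpos : s.pos = m) :
    (s.commit m k₀).potential m k₀ ≤ s.potential m k₀ + m ^ 2 := by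
  have hgain : (s.commit m k₀).gainPot m k₀ = s.gainPot m k₀ := by
    have e : (s.commit m k₀).gainPot m k₀ = s.gain + s.loops + s.balance * s.nextColour k₀ + 0 +
        stepAvg^[m] (payFun k₀ (s.block + 1) (s.commit m k₀).default) 0 -
        walkMeanAbs m * ((s.block + 1 + 1 - k₀ : ℕ) : ℝ) := by
      simp [gainPot, ColouringState.commit]
    rw [e, stepAvg_iterate_payFun_zero, gainPot, hpos, Nat.sub_self, Function.iterate_zero, id,
      payFun, nextColour]
    split_ifs with hk
    · rw [show s.block + 1 + 1 - k₀ = (s.block + 1 - k₀) + 1 by omega]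
      push_cast
      ring
    · rw [show s.block + 1 + 1 - k₀ = 0 by omega, show s.block + 1 - k₀ = 0 by omega]
      ring
  set D : ℤ := s.nextBias m k₀ with hD
  set κ' : ℤ := if D ≤ 0 then 1 else -1 with hκ'
  set g : ℝ := stepAvg^[m] (signFun k₀ (s.block + 1) κ') 0 with hg
  have hκ1 : κ' = 1 ∨ κ' = -1 := by rw [hκ']; split_ifs <;> simp
  have hold : s.biasPot m k₀ = D := by
    rw [biasPot, hpos, Nat.sub_self, Function.iterate_zero, id, hD, nextBias, signFun, nextColour]
    push_cast
    ring
  have hnew : (s.commit m k₀).biasPot m k₀ = D + m * g := by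
    simp [biasPot, ColouringState.commit, ← hD, ← hκ', hg]
  have hg1 : |g| ≤ 1 := abs_stepAvg_iterate_le (abs_signFun_le hκ1) m 0
  have hDg : (D : ℝ) * g ≤ 0 := by
    have h0 := stepAvg_iterate_add_neg_nonneg
      (signFun_add_neg_nonneg (k₀ := k₀) (k := s.block + 1) hκ1) m 0
    rw [neg_zero, ← hg] at h0
    rw [hκ'] at h0
    split_ifs at h0 with hD0
    · have : (D : ℝ) ≤ 0 := by exact_mod_cast hD0
      push_cast at h0
      exact mul_nonpos_of_nonpos_of_nonneg this (by linarith)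
    · have : (0 : ℝ) ≤ D := by exact_mod_cast (not_le.1 hD0).le
      push_cast at h0
      exact mul_nonpos_of_nonneg_of_nonpos this (by linarith)
  have hg2 : g ^ 2 ≤ 1 := by rw [← sq_abs]; exact pow_le_one₀ (abs_nonneg _) hg1
  unfold potential
  rw [hgain, hold, hnew]
  have hm : (0 : ℝ) ≤ m := Nat.cast_nonneg m
  nlinarith [mul_nonneg (sq_nonneg (m : ℝ)) (sub_nonneg.2 hg2), mul_nonneg hm (neg_nonneg.2 hDg)]

/-- The Lipschitz constant of the expected increment of the corrected bias. -/
def drift (m k₀ k : ℕ) : ℝ := if k₀ ≤ k then 1 + 2 * m else 1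

theorem drift_le (m k₀ k : ℕ) : drift m k₀ k ≤ 1 + 2 * m := by
  unfold drift
  split_ifs
  · exact le_rfl
  · have : (0 : ℝ) ≤ m := Nat.cast_nonneg m
    linarith

theorem one_le_drift (m k₀ k : ℕ) : 1 ≤ drift m k₀ k := by
  have : (0 : ℝ) ≤ m := Nat.cast_nonneg m
  unfold drift
  split_ifs <;> linarith

theorem sum_toReal_attachProb (G : Multigraph (Fin t) (Fin t)) :
    ∑ i, (G.attachProb i).toReal = 1 := by
  rw [← ENNReal.toReal_sum, G.sum_attachProb, ENNReal.toReal_one]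
  intro i _ h
  have := G.sum_attachProb
  rw [ENNReal.sum_eq_top.2 ⟨i, Finset.mem_univ i, h⟩] at this
  exact ENNReal.top_ne_one this

/-- An instance of `sum_mul_sq_le`. Before `k₀` the block colour is fixed, so a target moves the
bias only by its own colour and the Lipschitz constant is 1. Under the majority rule it also shifts
the expected block colour, which is weighted by at most `2m`. -/
theorem Consistent.sum_biasPot_push_sq_le (h : s.Consistent m) (hpos : s.pos < m) :
    ∑ i, (s.graph.attachProb i).toReal * (s.push m i).biasPot m k₀ ^ 2 ≤
      s.biasPot m k₀ ^ 2 + 2 * |s.biasPot m k₀| *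
        (drift m k₀ s.block * |(s.bias : ℝ) / (2 * t + 1)| +
          5 * m * ((s.pos + s.loops + 1 : ℝ) / (2 * t + 1))) + (5 * m) ^ 2 := by
  obtain ⟨r, hr⟩ : ∃ r, m - s.pos = r + 1 := ⟨m - s.pos - 1, by omega⟩
  have hr' : m - (s.pos + 1) = r := by omega
  set g := stepAvg^[r] (signFun k₀ s.block s.default) with hg
  have hm : (1 : ℝ) ≤ m := by exact_mod_cast (by omega : 1 ≤ m)
  have hl0 : (0 : ℝ) ≤ s.loops := by exact_mod_cast h.loops_nonneg
  have hl1 : (s.loops : ℝ) ≤ m := by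
    have : s.loops ≤ m := h.loops_le.trans (by exact_mod_cast hpos.le)
    exact_mod_cast this
  have hg1 : ∀ x, |g x| ≤ 1 := abs_stepAvg_iterate_le (abs_signFun_le h.default_eq) r
  have hpot : s.biasPot m k₀ = s.bias + (m + s.loops) *
      ((g (s.balance + 1) + g (s.balance - 1)) / 2) := by
    rw [biasPot, hr, Function.iterate_succ_apply']
    rfl
  set F : ℤ → ℝ := fun c => (s.bias + c : ℝ) +
      (m + (s.loops + (1 - (c : ℝ) ^ 2))) * g (s.balance + c) with hF
  have hpush : ∀ i, (s.push m i).biasPot m k₀ = F (s.targetColour m i) := by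
    intro i
    simp only [hF, biasPot, ColouringState.push, hr', hg]
    push_cast
    ring
  have hF1 : F 1 = s.bias + 1 + (m + s.loops) * g (s.balance + 1) := by simp [hF]
  have hF2 : F (-1) = s.bias - 1 + (m + s.loops) * g (s.balance - 1) := by
    simp [hF, sub_eq_add_neg]
  have hF0 : F 0 = s.bias + (m + s.loops) * g s.balance + g s.balance := by
    simp only [hF, add_zero, Int.cast_zero]; ring
  simp only [hpush]
  have b1 := abs_le.1 (hg1 (s.balance + 1))
  have b2 := abs_le.1 (hg1 (s.balance - 1))
  have b0 := abs_le.1 (hg1 s.balance)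
  have hq : ∀ x : ℝ, -1 ≤ x → x ≤ 1 → |(m + s.loops) * x| ≤ 2 * m := by
    intro x h1 h2
    rw [abs_mul, abs_of_nonneg (by linarith)]
    have : |x| ≤ 1 := abs_le.2 ⟨h1, h2⟩
    nlinarith [abs_nonneg x]
  refine sum_mul_sq_le (h := F) (fun i => ENNReal.toReal_nonneg) (sum_toReal_attachProb _)
    (h.targetColour_eq hpos) (h.sum_attachProb_mul_targetColour hpos)
    (h.sum_attachProb_mul_one_sub_sq hpos) ?_ ?_ ?_
  · rw [hpot]
    rw [hF1, hF2]
    ring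
  · unfold drift
    rw [hF1, hF2]
    split_ifs with hk
    · have := abs_le.1 (hq ((g (s.balance + 1) - g (s.balance - 1)) / 2)
        (by linarith) (by linarith))
      rw [abs_le]
      constructor <;> linarith
    · have : g = fun _ => (s.default : ℝ) := by
        rw [hg, signFun_of_lt (not_le.1 hk)]
        ext x
        exact stepAvg_iterate_const _ _ _
      simp only [this]
      ring_nf
      simp
  · have c1 := abs_le.1 (hq _ b1.1 b1.2)
    have c2 := abs_le.1 (hq _ b2.1 b2.2)
    have c0 := abs_le.1 (hq _ b0.1 b0.2)
    rw [hpot]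
    rintro j (rfl | rfl | rfl)
    · rw [hF0, abs_le]
      constructor <;> linarith
    · rw [hF1, abs_le]
      constructor <;> linarith
    · rw [hF2, abs_le]
      constructor <;> linarith

theorem Consistent.sum_gainPot_push_sq_le (h : s.Consistent m) (hpos : s.pos < m) :
    ∑ i, (s.graph.attachProb i).toReal * (s.push m i).gainPot m k₀ ^ 2 ≤
      s.gainPot m k₀ ^ 2 + 2 * |s.gainPot m k₀| *
        (1 * |(s.bias : ℝ) / (2 * t + 1)| +
          5 * m * ((s.pos + s.loops + 1 : ℝ) / (2 * t + 1))) + (5 * m) ^ 2 := by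
  obtain ⟨r, hr⟩ : ∃ r, m - s.pos = r + 1 := ⟨m - s.pos - 1, by omega⟩
  have hr' : m - (s.pos + 1) = r := by omega
  set f := stepAvg^[r] (payFun k₀ s.block s.default) with hf
  have hm : (1 : ℝ) ≤ m := by exact_mod_cast (by omega : 1 ≤ m)
  have hf1 : ∀ x, |f (x + 1) - f x| ≤ 1 :=
    abs_stepAvg_iterate_sub_le (abs_payFun_succ_sub_le h.default_eq) r
  set β := walkMeanAbs m * ((s.block + 1 - k₀ : ℕ) : ℝ) with hβ
  have hpot : s.gainPot m k₀ = s.gain + s.loops +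
      ((f (s.balance + 1) + f (s.balance - 1)) / 2) - β := by
    rw [gainPot, hr, Function.iterate_succ_apply']
    rfl
  set F : ℤ → ℝ := fun c => s.gain +
      (s.loops + (1 - (c : ℝ) ^ 2)) + f (s.balance + c) - β with hF
  have hpush : ∀ i, (s.push m i).gainPot m k₀ = F (s.targetColour m i) := by
    intro i
    simp only [hF, gainPot, ColouringState.push, hr', hf, hβ]
    push_cast
    ring
  simp only [hpush]
  have b1 := abs_le.1 (hf1 s.balance)
  have b2 := abs_le.1 (hf1 (s.balance - 1))
  rw [sub_add_cancel] at b2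
  refine sum_mul_sq_le (h := F) (fun i => ENNReal.toReal_nonneg) (sum_toReal_attachProb _)
    (h.targetColour_eq hpos) (h.sum_attachProb_mul_targetColour hpos)
    (h.sum_attachProb_mul_one_sub_sq hpos) ?_ ?_ ?_
  · rw [hpot]
    simp only [hF]
    push_cast
    rw [← sub_eq_add_neg]
    ring
  · simp only [hF]
    push_cast
    rw [← sub_eq_add_neg, abs_le]
    constructor <;> linarith
  · rw [hpot]
    simp only [hF]
    rintro j (rfl | rfl | rfl) <;> push_cast
    · rw [add_zero, abs_le]
      constructor <;> linarith
    · rw [abs_le]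
      constructor <;> linarith
    · rw [← sub_eq_add_neg, abs_le]
      constructor <;> linarith

theorem Consistent.abs_bias_le (h : s.Consistent m) (hpos : s.pos ≤ m) :
    |(s.bias : ℝ)| ≤ |s.biasPot m k₀| + 2 * m := by
  have hl0 : (0 : ℝ) ≤ s.loops := by exact_mod_cast h.loops_nonneg
  have hl1 : (s.loops : ℝ) ≤ m := by
    have : s.loops ≤ m := h.loops_le.trans (by exact_mod_cast hpos)
    exact_mod_cast this
  have hg1 := abs_stepAvg_iterate_le
    (abs_signFun_le (k₀ := k₀) (k := s.block) h.default_eq) (m - s.pos) s.balance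
  set g := stepAvg^[m - s.pos] (signFun k₀ s.block s.default) s.balance with hg
  have e : (s.bias : ℝ) = s.biasPot m k₀ - (m + s.loops) * g := by rw [biasPot, ← hg]; ring
  have : |(m + s.loops : ℝ) * g| ≤ 2 * m := by
    rw [abs_mul, abs_of_nonneg (by positivity)]
    nlinarith [abs_nonneg g]
  calc |(s.bias : ℝ)| = |s.biasPot m k₀ - (m + s.loops) * g| := by rw [← e]
    _ ≤ |s.biasPot m k₀| + |(m + s.loops) * g| := abs_sub _ _
    _ ≤ _ := by linarith

/-- The potential grows slowly in expectation. -/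
theorem Consistent.sum_potential_next_le (h : s.Consistent m) (hpos : s.pos < m) :
    ∑ i, (s.graph.attachProb i).toReal * (s.next m k₀ i).potential m k₀ ≤
      (1 + (2 * drift m k₀ s.block + 5 / 4) / (2 * t + 1)) * s.potential m k₀ +
        2200 * (m : ℝ) ^ 4 := by
  have hm : (1 : ℝ) ≤ m := by exact_mod_cast (by omega : 1 ≤ m)
  have hnext : ∀ i, (s.next m k₀ i).potential m k₀ ≤
      (s.push m i).biasPot m k₀ ^ 2 + (s.push m i).gainPot m k₀ ^ 2 + m ^ 2 := by
    intro i
    unfold ColouringState.next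
    split_ifs with hm
    · exact potential_commit_le hm
    · unfold potential
      have := sq_nonneg (m : ℝ)
      linarith
  have hsum : ∑ i, (s.graph.attachProb i).toReal * (s.next m k₀ i).potential m k₀ ≤
      ∑ i, (s.graph.attachProb i).toReal * (s.push m i).biasPot m k₀ ^ 2 +
      ∑ i, (s.graph.attachProb i).toReal * (s.push m i).gainPot m k₀ ^ 2 + m ^ 2 := by
    calc _ ≤ ∑ i, (s.graph.attachProb i).toReal *
          ((s.push m i).biasPot m k₀ ^ 2 + (s.push m i).gainPot m k₀ ^ 2 + m ^ 2) :=
          Finset.sum_le_sum fun i _ => mul_le_mul_of_nonneg_left (hnext i) ENNReal.toReal_nonneg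
      _ = _ := by
          simp only [mul_add, Finset.sum_add_distrib, ← Finset.sum_mul]
          rw [sum_toReal_attachProb, one_mul]
  have h1 := h.sum_biasPot_push_sq_le (k₀ := k₀) hpos
  have h2 := h.sum_gainPot_push_sq_le (k₀ := k₀) hpos
  have h3 := h.abs_bias_le (k₀ := k₀) hpos.le
  have hα1 := one_le_drift m k₀ s.block
  have hα2 := drift_le m k₀ s.block
  set α := drift m k₀ s.block
  have hN : (1 : ℝ) ≤ 2 * t + 1 := by have : (0 : ℝ) ≤ t := Nat.cast_nonneg t; linarith
  set N : ℝ := 2 * t + 1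
  have hz : (s.pos + s.loops + 1 : ℝ) ≤ 2 * m := by
    have h4 : (s.pos : ℤ) + s.loops + 1 ≤ 2 * m := by
      have := h.loops_le
      omega
    exact_mod_cast h4
  set z : ℝ := s.pos + s.loops + 1
  unfold potential at hsum ⊢
  set X := s.biasPot m k₀
  set Y := s.gainPot m k₀
  set b : ℝ := (s.bias : ℝ)
  rw [abs_div, abs_of_pos (by linarith : 0 < N)] at h1 h2
  have hinv : ∀ u C : ℝ, 0 ≤ C → u / N + C / N ≤ u / N + C := fun u C hC => by
    have := div_le_self hC hN
    linarith
  -- Here `16 m²` covers `2mα + 10m²`, and Young's inequality gives `2|X| * 16m² ≤ X²/4 + 4(16m²)²`.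
  -- In `k2` the cross term `2|X||Y| ≤ X² + Y²` completes the `5/4`.
  have k1 : 2 * |X| * (α * (|b| / N) + 5 * m * (z / N)) ≤
      (2 * α + 1 / 4) * X ^ 2 / N + 4 * (16 * (m : ℝ) ^ 2) ^ 2 := by
    refine le_trans ?_ (hinv _ _ (by positivity))
    rw [show 2 * |X| * (α * (|b| / N) + 5 * m * (z / N)) =
      (2 * |X| * (α * |b| + 5 * m * z)) / N by ring, ← add_div]
    refine div_le_div_of_nonneg_right ?_ (by linarith)
    have q1 : α * |b| + 5 * m * z ≤ α * |X| + 16 * (m : ℝ) ^ 2 := by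
      have q2 : α * |b| ≤ α * (|X| + 2 * m) := mul_le_mul_of_nonneg_left h3 (by linarith)
      have q3 : 5 * m * z ≤ 5 * m * (2 * m) := mul_le_mul_of_nonneg_left hz (by linarith)
      nlinarith
    have q4 := mul_le_mul_of_nonneg_left q1 (by positivity : 0 ≤ 2 * |X|)
    rw [← sq_abs X]
    nlinarith [sq_nonneg (|X| / 2 - 2 * (16 * (m : ℝ) ^ 2))]
  have k2 : 2 * |Y| * (1 * (|b| / N) + 5 * m * (z / N)) ≤
      (X ^ 2 + 5 / 4 * Y ^ 2) / N + 4 * (16 * (m : ℝ) ^ 2) ^ 2 := by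
    refine le_trans ?_ (hinv _ _ (by positivity))
    rw [show 2 * |Y| * (1 * (|b| / N) + 5 * m * (z / N)) =
      (2 * |Y| * (|b| + 5 * m * z)) / N by ring, ← add_div]
    refine div_le_div_of_nonneg_right ?_ (by linarith)
    have q1 : |b| + 5 * m * z ≤ |X| + 16 * (m : ℝ) ^ 2 := by
      have q3 : 5 * m * z ≤ 5 * m * (2 * m) := mul_le_mul_of_nonneg_left hz (by linarith)
      nlinarith
    have q4 := mul_le_mul_of_nonneg_left q1 (by positivity : 0 ≤ 2 * |Y|)
    rw [← sq_abs X, ← sq_abs Y]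
    nlinarith [sq_nonneg (|Y| / 2 - 2 * (16 * (m : ℝ) ^ 2)), sq_nonneg (|X| - |Y|)]
  have k3 : (2 * α + 1 / 4) * X ^ 2 / N + (X ^ 2 + 5 / 4 * Y ^ 2) / N ≤
      (2 * α + 5 / 4) / N * (X ^ 2 + Y ^ 2) := by
    rw [← add_div, div_mul_eq_mul_div (2 * α + 5 / 4)]
    refine div_le_div_of_nonneg_right ?_ (by linarith)
    have := mul_nonneg (by linarith : 0 ≤ α) (sq_nonneg Y)
    linarith
  -- The additive terms total `2048 m⁴ + 51 m²`, which is below `2200 m⁴`.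
  have k4 : (m : ℝ) ^ 2 ≤ (m : ℝ) ^ 4 := pow_le_pow_right₀ hm (by norm_num)
  have k5 : (0 : ℝ) ≤ (m : ℝ) ^ 4 := by positivity
  linarith

end ColouringState

end Potential

/-! ### Growth of the expected potential -/

theorem PMF.tsum_bind_mul {α β : Type*} (p : PMF α) (f : α → PMF β) (F : β → ℝ≥0∞) :
    ∑' b, p.bind f b * F b = ∑' a, p a * ∑' b, f a b * F b := by
  simp only [PMF.bind_apply, ← ENNReal.tsum_mul_right, ← ENNReal.tsum_mul_left]
  rw [ENNReal.tsum_comm]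
  simp only [mul_assoc]

theorem PMF.tsum_pure_mul {α : Type*} (a : α) (F : α → ℝ≥0∞) :
    ∑' b, PMF.pure a b * F b = F a := by
  rw [tsum_eq_single a]
  · simp
  · intro b hb
    simp [PMF.pure_apply, hb]

theorem PMF.tsum_map_mul {α β : Type*} (p : PMF α) (g : α → β) (F : β → ℝ≥0∞) :
    ∑' b, p.map g b * F b = ∑' a, p a * F (g a) := by
  rw [PMF.map, PMF.tsum_bind_mul]
  simp only [Function.comp_apply, PMF.tsum_pure_mul]

/-- Markov's inequality for a probability mass function. -/
theorem PMF.toOuterMeasure_lt_le {α : Type*} (p : PMF α) {F : α → ℝ} {B : ℝ} (hB : 0 < B) :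
    p.toOuterMeasure {a | B < F a} ≤ (∑' a, p a * ENNReal.ofReal (F a)) / ENNReal.ofReal B := by
  rw [PMF.toOuterMeasure_apply, ENNReal.le_div_iff_mul_le
    (Or.inl (ENNReal.ofReal_pos.2 hB).ne') (Or.inl ENNReal.ofReal_ne_top),
    ← ENNReal.tsum_mul_right]
  refine ENNReal.tsum_le_tsum fun a => ?_
  by_cases ha : a ∈ {a | B < F a}
  · rw [Set.indicator_of_mem ha]
    gcongr
    exact le_of_lt ha
  · rw [Set.indicator_of_notMem ha, zero_mul]
    exact zero_le

/-- `K N^b` with `N = 2t + 1` is a supersolution: since `N` grows by 2, Bernoulli gives a relative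
increase of at least `2b/N`. The excess of `2b` over `a` absorbs the constant `C`. -/
theorem le_mul_rpow_of_recurrence {u : ℕ → ℝ≥0∞} {a b C K : ℝ} {s T : ℕ} (ha : 0 ≤ a)
    (hb : 1 ≤ b) (hC : 0 ≤ C) (hK : 0 ≤ K) (hab : a ≤ 2 * b)
    (hu : u s ≤ ENNReal.ofReal (K * (2 * s + 1 : ℝ) ^ b))
    (hgap : C ≤ (2 * b - a) * (K * (2 * s + 1 : ℝ) ^ (b - 1)))
    (hstep : ∀ t, s ≤ t → t < T →
      u (t + 1) ≤ ENNReal.ofReal (1 + a / (2 * t + 1)) * u t + ENNReal.ofReal C)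
    {t : ℕ} (hst : s ≤ t) (htT : t ≤ T) : u t ≤ ENNReal.ofReal (K * (2 * t + 1 : ℝ) ^ b) := by
  induction t, hst using Nat.le_induction with
  | base => exact hu
  | succ t hst ih =>
    refine (hstep t hst htT).trans ?_
    have ih := ih (by omega)
    have hN : (0 : ℝ) < 2 * t + 1 := by positivity
    have hNs : (2 * s + 1 : ℝ) ≤ 2 * t + 1 := by
      have : (s : ℝ) ≤ t := by exact_mod_cast hst
      linarith
    have hs1 : (0 : ℝ) < 2 * s + 1 := by positivity
    push_cast
    rw [show (2 * (t + 1 : ℝ) + 1) = (2 * t + 1) + 2 by ring]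
    generalize (2 * t + 1 : ℝ) = N at *
    calc ENNReal.ofReal (1 + a / N) * u t + ENNReal.ofReal C
        ≤ ENNReal.ofReal (1 + a / N) * ENNReal.ofReal (K * N ^ b) + ENNReal.ofReal C := by gcongr
      _ = ENNReal.ofReal ((1 + a / N) * (K * N ^ b) + C) := by
        rw [← ENNReal.ofReal_mul (by positivity), ← ENNReal.ofReal_add (by positivity) hC]
      _ ≤ ENNReal.ofReal (K * (N + 2) ^ b) := by
        refine ENNReal.ofReal_le_ofReal ?_
        have h1 : (N + 2) ^ b = N ^ b * (1 + 2 / N) ^ b := by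
          rw [← Real.mul_rpow hN.le (by positivity)]
          congr 1
          field_simp
        have h2 : 1 + b * (2 / N) ≤ (1 + 2 / N) ^ b :=
          one_add_mul_self_le_rpow_one_add (by have : 0 ≤ 2 / N := by positivity
                                               linarith) hb
        have h3 : N ^ (b - 1) = N ^ b / N := Real.rpow_sub_one hN.ne' b
        have h4 : (2 * s + 1 : ℝ) ^ (b - 1) ≤ N ^ (b - 1) :=
          Real.rpow_le_rpow hs1.le hNs (by linarith)
        have h5 : C ≤ (2 * b - a) * (K * (N ^ b / N)) := by
          rw [← h3]
          refine hgap.trans ?_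
          refine mul_le_mul_of_nonneg_left ?_ (by linarith)
          exact mul_le_mul_of_nonneg_left h4 hK
        have h6 : K * (N ^ b * (1 + b * (2 / N))) ≤ K * (N + 2) ^ b := by
          rw [h1]
          gcongr
        refine le_trans ?_ h6
        have h7 : K * (N ^ b * (1 + b * (2 / N))) =
            (1 + a / N) * (K * N ^ b) + (2 * b - a) * (K * (N ^ b / N)) := by
          field_simp
          ring
        linarith

/-- The expected potential after `t` steps. -/
def meanPotential (m k₀ t : ℕ) : ℝ≥0∞ :=
  ∑' s, colouringLaw m k₀ t s * ENNReal.ofReal (s.potential m k₀)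

theorem meanPotential_zero_le (m k₀ : ℕ) : meanPotential m k₀ 0 ≤ ENNReal.ofReal ((m : ℝ) ^ 2) := by
  rw [meanPotential, colouringLaw, PMF.tsum_pure_mul]
  refine ENNReal.ofReal_le_ofReal ?_
  have h1 : (init.gainPot m k₀ : ℝ) = 0 := by
    have e : init.gainPot m k₀ = stepAvg^[m] (payFun k₀ 0 1) 0 -
        walkMeanAbs m * ((0 + 1 - k₀ : ℕ) : ℝ) := by
      simp [gainPot, init]
    rw [e, stepAvg_iterate_payFun_zero]
    split_ifs with h
    · obtain rfl : k₀ = 0 := by omega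
      simp
    · rw [show 0 + 1 - k₀ = 0 by omega]
      simp
  have h2 : |(init.biasPot m k₀ : ℝ)| ≤ m := by
    have e : init.biasPot m k₀ = m * stepAvg^[m] (signFun k₀ 0 1) 0 := by
      simp [biasPot, init]
    rw [e, abs_mul, Nat.abs_cast]
    exact mul_le_of_le_one_right (Nat.cast_nonneg m)
      (abs_stepAvg_iterate_le (abs_signFun_le (Or.inl rfl)) m 0)
  rw [potential, h1, ← sq_abs (biasPot m k₀ init)]
  have := abs_nonneg (biasPot m k₀ init)
  nlinarith

theorem meanPotential_succ_le {m k₀ t : ℕ} (hm : 1 ≤ m) {α : ℝ}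
    (hα : ∀ k, k * m ≤ t → drift m k₀ k ≤ α) :
    meanPotential m k₀ (t + 1) ≤
      ENNReal.ofReal (1 + (2 * α + 5 / 4) / (2 * t + 1)) * meanPotential m k₀ t +
        ENNReal.ofReal (2200 * (m : ℝ) ^ 4) := by
  have hstep : ∀ s ∈ (colouringLaw m k₀ t).support,
      ∑' s', s.graph.attach.map (s.next m k₀) s' * ENNReal.ofReal (s'.potential m k₀) ≤
        ENNReal.ofReal (1 + (2 * α + 5 / 4) / (2 * t + 1)) * ENNReal.ofReal (s.potential m k₀) +
          ENNReal.ofReal (2200 * (m : ℝ) ^ 4) := by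
    intro s hs
    obtain ⟨hc, hpos⟩ := consistent_of_mem_support hm k₀ hs
    have hd := hα s.block (by have := hc.time; omega)
    have hd1 := one_le_drift m k₀ s.block
    have hfac : 0 ≤ 1 + (2 * α + 5 / 4) / (2 * t + 1) := by
      have : 0 ≤ α := by linarith
      positivity
    rw [PMF.tsum_map_mul, tsum_fintype]
    have hne : ∀ i, s.graph.attachProb i ≠ ∞ := by
      intro i h
      have := s.graph.sum_attachProb
      rw [ENNReal.sum_eq_top.2 ⟨i, Finset.mem_univ i, h⟩] at this
      exact ENNReal.top_ne_one this
    have e : ∀ i, s.graph.attach i * ENNReal.ofReal ((s.next m k₀ i).potential m k₀) =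
        ENNReal.ofReal ((s.graph.attachProb i).toReal * (s.next m k₀ i).potential m k₀) := by
      intro i
      rw [ENNReal.ofReal_mul ENNReal.toReal_nonneg, ENNReal.ofReal_toReal (hne i)]
      rfl
    rw [Finset.sum_congr rfl fun i _ => e i, ← ENNReal.ofReal_sum_of_nonneg
      (fun i _ => mul_nonneg ENNReal.toReal_nonneg (potential_nonneg _)),
      ← ENNReal.ofReal_mul hfac, ← ENNReal.ofReal_add
      (mul_nonneg hfac (potential_nonneg _)) (by positivity)]
    refine ENNReal.ofReal_le_ofReal ((hc.sum_potential_next_le hpos).trans ?_)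
    have := potential_nonneg (m := m) (k₀ := k₀) s
    gcongr
  rw [meanPotential, colouringLaw, PMF.tsum_bind_mul, meanPotential, ← ENNReal.tsum_mul_left]
  calc _ ≤ ∑' s, (ENNReal.ofReal (1 + (2 * α + 5 / 4) / (2 * t + 1)) *
          (colouringLaw m k₀ t s * ENNReal.ofReal (s.potential m k₀)) +
          colouringLaw m k₀ t s * ENNReal.ofReal (2200 * (m : ℝ) ^ 4)) := by
        refine ENNReal.tsum_le_tsum fun s => ?_
        by_cases hs : s ∈ (colouringLaw m k₀ t).support
        · calc _ ≤ colouringLaw m k₀ t s * _ := mul_le_mul_right (hstep s hs) _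
            _ = _ := by ring
        · rw [(PMF.apply_eq_zero_iff _ _).2 hs]
          simp
    _ = _ := by
        rw [ENNReal.tsum_add, ENNReal.tsum_mul_right, PMF.tsum_coe, one_mul]

theorem meanPotential_le {m k₀ n : ℕ} (hm : 1 ≤ m) (hk : k₀ ≤ n) :
    meanPotential m k₀ (n * m) ≤ ENNReal.ofReal (8800 * (m : ℝ) ^ 4 *
      (2 * (k₀ * m : ℕ) + 1 : ℝ) ^ (7 / 4 : ℝ) *
      ((2 * (n * m : ℕ) + 1 : ℝ) / (2 * (k₀ * m : ℕ) + 1)) ^ (2 * m + 2 : ℝ)) := by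
  have hm' : (1 : ℝ) ≤ m := by exact_mod_cast hm
  have hm4 : (1 : ℝ) ≤ (m : ℝ) ^ 4 := one_le_pow₀ hm'
  have hm2 : (m : ℝ) ^ 2 ≤ (m : ℝ) ^ 4 := pow_le_pow_right₀ hm' (by norm_num)
  have h1 : meanPotential m k₀ (k₀ * m) ≤ ENNReal.ofReal
      (8800 * (m : ℝ) ^ 4 * (2 * (k₀ * m : ℕ) + 1 : ℝ) ^ (7 / 4 : ℝ)) := by
    -- With drift 1 the recurrence has `a/2 = 13/8`; the exponent `7/4` lies strictly between this
    -- and 2. The gap `2b - a = 1/4` explains `8800 = 4 * 2200`.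
    refine le_mul_rpow_of_recurrence (a := 2 * 1 + 5 / 4) (C := 2200 * (m : ℝ) ^ 4)
      (s := 0) (T := k₀ * m) (by norm_num) (by norm_num) (by positivity) (by positivity)
      (by norm_num) ?_ ?_ ?_ (Nat.zero_le _) le_rfl
    · refine (meanPotential_zero_le m k₀).trans (ENNReal.ofReal_le_ofReal ?_)
      norm_num
      linarith
    · norm_num
      linarith
    · intro t _ ht
      refine meanPotential_succ_le hm fun k hkt => ?_
      have : k < k₀ := lt_of_mul_lt_mul_right (hkt.trans_lt ht) (Nat.zero_le m)
      simp [drift, this.not_ge]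
  have hN : (1 : ℝ) ≤ 2 * (k₀ * m : ℕ) + 1 := by
    have : (0 : ℝ) ≤ (k₀ * m : ℕ) := Nat.cast_nonneg _
    linarith
  set N : ℝ := 2 * (k₀ * m : ℕ) + 1 with hNdef
  have hN0 : 0 < N := by linarith
  set b : ℝ := 2 * m + 2 with hb
  -- `K` makes the supersolution agree at time `k₀ m` with the bound from the first phase. The large
  -- exponent `b` then acts only on the ratio of the two times.
  have h2 := le_mul_rpow_of_recurrence (u := meanPotential m k₀) (a := 2 * (1 + 2 * m) + 5 / 4)
      (b := b) (C := 2200 * (m : ℝ) ^ 4) (K := 8800 * (m : ℝ) ^ 4 * N ^ (7 / 4 : ℝ) / N ^ b)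
      (s := k₀ * m) (T := n * m) (by positivity) (by linarith) (by positivity) (by positivity)
      (by linarith) ?_ ?_ (fun t _ _ => meanPotential_succ_le hm fun k _ => drift_le m k₀ k)
      (Nat.mul_le_mul_right m hk) le_rfl
  · refine h2.trans (le_of_eq ?_)
    rw [Real.div_rpow (by positivity) hN0.le]
    congr 1
    ring
  · rw [← hNdef, div_mul_cancel₀ _ (Real.rpow_pos_of_pos hN0 b).ne']
    exact h1
  · have e : 8800 * (m : ℝ) ^ 4 * N ^ (7 / 4 : ℝ) / N ^ b * N ^ (b - 1) =
        8800 * (m : ℝ) ^ 4 * N ^ (3 / 4 : ℝ) := by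
      rw [Real.rpow_sub_one hN0.ne', show (3 / 4 : ℝ) = 7 / 4 - 1 by norm_num,
        Real.rpow_sub_one hN0.ne']
      have := (Real.rpow_pos_of_pos hN0 b).ne'
      field_simp
    rw [← hNdef, e]
    have h34 : 1 ≤ N ^ (3 / 4 : ℝ) := Real.one_le_rpow hN (by norm_num)
    have : (2 * b - (2 * (1 + 2 * (m : ℝ)) + 5 / 4)) = 3 / 4 := by rw [hb]; ring
    rw [this]
    nlinarith

/-! ### From small potential to the modularity bound -/

/-- A state with small potential yields a good colouring of the identified multigraph. -/
theorem ColouringState.Consistent.le_modularity {m k₀ n : ℕ} {s : ColouringState (n * m)}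
    (h : s.Consistent m) (hpos : s.pos < m) (hn : 1 ≤ n) (hk : k₀ ≤ n) {δ : ℝ} (hδ : 0 ≤ δ)
    (hpot : s.potential m k₀ ≤ (δ * n) ^ 2) :
    (walkMeanAbs m * (n - k₀) - δ * n) / (2 * (n * m)) -
      (δ * n + 2 * m) ^ 2 / (8 * (n * m) ^ 2) ≤ (s.graph.mapVertices Fin.divNat).modularity := by
  have hm : 0 < m := by omega
  have hblock : s.block = n := by
    have h1 : n * m / m = (s.block * m + s.pos) / m := by rw [← h.time]
    rw [Nat.mul_div_cancel _ hm, mul_comm s.block, Nat.mul_add_div hm, Nat.div_eq_of_lt hpos] at h1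
    omega
  have hpos0 : s.pos = 0 := by
    have := h.time
    rw [hblock] at this
    omega
  have hloops : s.loops = 0 := by
    have h1 := h.loops_nonneg
    have h2 := h.loops_le
    rw [hpos0] at h2
    push_cast at h2
    omega
  have hbal : s.balance = 0 := by
    have := h.abs_balance_le
    rw [hpos0] at this
    exact abs_eq_zero.1 (le_antisymm (by simpa using this) (abs_nonneg _))
  have hcol : (fun v : Fin (n * m) => Function.update s.colour s.block 0 (v / m)) =
      (fun v : Fin n => s.colour v) ∘ Fin.divNat := by
    ext v
    have : (v : ℕ) / m ≠ s.block := by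
      rw [hblock]
      exact (Nat.div_lt_of_lt_mul (lt_of_lt_of_eq v.2 (mul_comm n m))).ne
    rw [Function.update_of_ne this]
    rfl
  have hS : (s.graph.mapVertices Fin.divNat).edgeSum (fun v : Fin n => s.colour v) = s.bias := by
    rw [edgeSum_mapVertices, ← hcol, h.edgeSum_eq]
    simp
  have hP : (s.graph.mapVertices Fin.divNat).edgeProd (fun v : Fin n => s.colour v) = s.gain := by
    rw [edgeProd_mapVertices, ← hcol, h.edgeProd_eq]
    simp
  have hcard : 0 < Fintype.card (Fin (n * m)) := by
    rw [Fintype.card_fin]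
    positivity
  have key := (s.graph.mapVertices Fin.divNat).le_modularity_of_colouring hcard
    (fun v : Fin n => s.colour v) (fun v => h.colour_eq v (by rw [hblock]; exact v.2))
  rw [hS, hP, Fintype.card_fin] at key
  push_cast at key
  refine le_trans ?_ key
  have hδn : 0 ≤ δ * n := by positivity
  have hX : |s.biasPot m k₀| ≤ δ * n := abs_le_of_sq_le_sq
    (by rw [potential] at hpot; nlinarith [sq_nonneg (s.gainPot m k₀)]) hδn
  have hY : |s.gainPot m k₀| ≤ δ * n := abs_le_of_sq_le_sq
    (by rw [potential] at hpot; nlinarith [sq_nonneg (s.biasPot m k₀)]) hδn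
  -- The empty block with index `n` adds `walkMeanAbs m`, cancelling one of the `n + 1 - k₀`
  -- compensated blocks.
  have hgain : s.gainPot m k₀ = s.gain - walkMeanAbs m * (n - k₀) := by
    rw [gainPot, hloops, hbal, hpos0, Nat.sub_zero, stepAvg_iterate_payFun_zero, hblock,
      if_pos hk, Nat.sub_add_comm hk]
    push_cast [hk]
    ring
  have hb := (h.abs_bias_le (k₀ := k₀) hpos.le).trans (add_le_add_left hX (2 * (m : ℝ)))
  rw [hgain] at hY
  have hb2 : (s.bias : ℝ) ^ 2 ≤ (δ * n + 2 * m) ^ 2 := by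
    rw [← sq_abs (s.bias : ℝ)]
    exact pow_le_pow_left₀ (abs_nonneg _) hb 2
  have hg : walkMeanAbs m * (n - k₀) - δ * n ≤ s.gain := by
    have := (abs_le.1 hY).1
    linarith
  gcongr

/-- The probability that the modularity of `G_m^n` is less than `b`. -/
def probModularityLT (m n : ℕ) (b : ℝ) : ℝ≥0∞ :=
  (prefAttach m n).toMeasure {G | G.modularity < b}

theorem probModularityLT_mono (m n : ℕ) : Monotone (probModularityLT m n) :=
  fun _ _ h => measure_mono fun _ hG => lt_of_lt_of_le hG h

theorem aasModularityGE_of_tendsto {m : ℕ} {b : ℕ → ℝ}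
    (h : Tendsto (fun n => probModularityLT m n (b n)) atTop (𝓝 0)) : AASModularityGE m b := by
  have e : ∀ n, (prefAttach m n).toMeasure {G | b n ≤ G.modularity} =
      1 - probModularityLT m n (b n) := by
    intro n
    have : {G : Multigraph (Fin n) (Fin (n * m)) | b n ≤ G.modularity} =
        {G | G.modularity < b n}ᶜ := by
      ext G
      simp
    rw [this, prob_compl_eq_one_sub (MeasurableSet.of_discrete), probModularityLT]
  unfold AASModularityGE
  simp only [e]
  simpa using ENNReal.Tendsto.sub tendsto_const_nhds h (Or.inl ENNReal.one_ne_top)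

/-- On the support of the coupling, low modularity forces a potential above `(δn)²`; Markov's
inequality bounds the probability of that. -/
theorem probModularityLT_le {m n k₀ : ℕ} (hm : 1 ≤ m) (hn : 1 ≤ n) (hk : k₀ ≤ n) {δ b : ℝ}
    (hδ : 0 < δ)
    (hb : b ≤ (walkMeanAbs m * (n - k₀) - δ * n) / (2 * (n * m)) -
      (δ * n + 2 * m) ^ 2 / (8 * (n * m) ^ 2)) :
    probModularityLT m n b ≤ meanPotential m k₀ (n * m) / ENNReal.ofReal ((δ * n) ^ 2) := by
  have hn' : (0 : ℝ) < n := by exact_mod_cast hn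
  refine le_trans ?_ (PMF.toOuterMeasure_lt_le _ (by positivity))
  rw [probModularityLT, PMF.toMeasure_apply_eq_toOuterMeasure_apply _ MeasurableSet.of_discrete,
    prefAttach, ← map_graph_colouringLaw m k₀, PMF.map_comp, PMF.toOuterMeasure_map_apply]
  refine PMF.toOuterMeasure_mono _ ?_
  rintro s ⟨hs, hsupp⟩
  obtain ⟨hc, hpos⟩ := consistent_of_mem_support hm k₀ hsupp
  by_contra hpot
  have hle := hc.le_modularity hpos hn hk hδ.le (not_lt.1 hpot)
  exact absurd hs (not_lt.2 (hb.trans hle))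

theorem tendsto_probModularityLT {m : ℕ} (hm : 1 ≤ m) {ε : ℝ} (hε : 0 < ε) :
    Tendsto (fun n => probModularityLT m n (binomialMeanDeviation m / m - ε)) atTop (𝓝 0) := by
  have hm' : (1 : ℝ) ≤ m := by exact_mod_cast hm
  -- Error budget: the blocks before `k₀` cost at most `δ`, the fluctuation of the gain `δ/2`, and
  -- the squared bias `δ/2`.
  obtain ⟨δ, hδ0, hδ1, hδε⟩ : ∃ δ : ℝ, 0 < δ ∧ δ ≤ 1 / 2 ∧ 2 * δ ≤ ε :=
    ⟨min (1 / 2) (ε / 2), by positivity, min_le_left _ _, by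
      linarith [min_le_right (1 / 2) (ε / 2)]⟩
  set c : ℝ := 8800 * (m : ℝ) ^ 4 * (3 * m : ℝ) ^ (7 / 4 : ℝ) *
    (1 / δ) ^ (2 * m + 2 : ℝ) / δ ^ 2 with hc
  have hlim : Tendsto (fun n : ℕ => ENNReal.ofReal (c * (n : ℝ) ^ (-(1 / 4) : ℝ))) atTop (𝓝 0) := by
    rw [← ENNReal.ofReal_zero]
    refine ENNReal.tendsto_ofReal ?_
    rw [← mul_zero c]
    exact ((tendsto_rpow_neg_atTop (by norm_num : (0 : ℝ) < 1 / 4)).comp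
      tendsto_natCast_atTop_atTop).const_mul c
  refine tendsto_of_tendsto_of_tendsto_of_le_of_le' tendsto_const_nhds hlim
    (Eventually.of_forall fun n => zero_le) ?_
  filter_upwards [eventually_ge_atTop 1, eventually_ge_atTop ⌈2 * m / δ⌉₊] with n hn hn2
  have hn' : (1 : ℝ) ≤ n := by exact_mod_cast hn
  have hn0 : (0 : ℝ) < n := by linarith
  have hnδ : 2 * m ≤ δ * n := by
    have : 2 * m / δ ≤ n := (Nat.le_ceil _).trans (by exact_mod_cast hn2)
    rw [div_le_iff₀ hδ0] at this
    linarith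
  set k₀ := ⌈δ * n⌉₊ with hk₀
  have hk1 : δ * n ≤ k₀ := Nat.le_ceil _
  have hk2 : (k₀ : ℝ) ≤ δ * n + 1 := (Nat.ceil_lt_add_one (by positivity)).le
  have hk : k₀ ≤ n := by
    rw [hk₀, Nat.ceil_le]
    nlinarith
  have hk' : (k₀ : ℝ) ≤ n := by exact_mod_cast hk
  have hμ := walkMeanAbs_le m
  have hμ0 := walkMeanAbs_nonneg m
  refine (probModularityLT_le hm hn hk hδ0 ?_).trans ?_
  · have e : binomialMeanDeviation m / m = walkMeanAbs m * n / (2 * (n * m)) := by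
      rw [walkMeanAbs_eq]
      field_simp
    have h1 : walkMeanAbs m * k₀ / (2 * (n * m)) ≤ δ := by
      rw [div_le_iff₀ (by positivity)]
      have : walkMeanAbs m * k₀ ≤ m * (2 * (δ * n)) :=
        mul_le_mul hμ (by linarith) (by positivity) (by positivity)
      linarith
    have h2 : δ * n / (2 * (n * m)) ≤ δ / 2 := by
      rw [div_le_iff₀ (by positivity)]
      have : δ * n * 1 ≤ δ * n * m := mul_le_mul_of_nonneg_left hm' (by positivity)
      linarith
    have h3 : (δ * n + 2 * m) ^ 2 / (8 * (n * m) ^ 2) ≤ δ / 2 := by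
      rw [div_le_iff₀ (by positivity)]
      have h4 : (δ * n + 2 * m) ^ 2 ≤ (2 * (δ * n)) ^ 2 :=
        pow_le_pow_left₀ (by positivity) (by linarith) 2
      have h5 : (n : ℝ) ^ 2 ≤ (n * m : ℝ) ^ 2 :=
        pow_le_pow_left₀ hn0.le (le_mul_of_one_le_right hn0.le hm') 2
      have h6 : δ * δ ≤ δ * 1 := mul_le_mul_of_nonneg_left (by linarith) hδ0.le
      have h7 : δ * δ * (n : ℝ) ^ 2 ≤ δ * 1 * (n * m : ℝ) ^ 2 := by gcongr
      linarith
    rw [e, sub_div, mul_sub, sub_div]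
    linarith
  · refine (ENNReal.div_le_div_right (meanPotential_le hm hk) _).trans ?_
    rw [← ENNReal.ofReal_div_of_pos (by positivity)]
    refine ENNReal.ofReal_le_ofReal ?_
    have hk0 : (0 : ℝ) ≤ k₀ := Nat.cast_nonneg _
    have h1 : (2 * (k₀ * m : ℕ) + 1 : ℝ) ≤ 3 * m * n := by
      push_cast
      nlinarith
    have h2 : (2 * (n * m : ℕ) + 1 : ℝ) / (2 * (k₀ * m : ℕ) + 1) ≤ 1 / δ := by
      rw [div_le_div_iff₀ (by positivity) hδ0]
      push_cast
      nlinarith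
    -- The decay rate `n^(-1/4)` is `7/4 - 2`; everything else depends on `m` and `δ` only.
    calc _ ≤ 8800 * (m : ℝ) ^ 4 * (3 * m * n : ℝ) ^ (7 / 4 : ℝ) *
          (1 / δ) ^ (2 * m + 2 : ℝ) / (δ * n) ^ 2 := by gcongr
      _ = c * (n : ℝ) ^ (-(1 / 4) : ℝ) := by
        rw [hc, Real.mul_rpow (by positivity) hn0.le,
          show (-(1 / 4) : ℝ) = 7 / 4 - (2 : ℕ) by norm_num, Real.rpow_sub_natCast hn0.ne']
        field_simp

/-- Diagonal choice: `e n` is the infimum of the `ε > 0` with `P n ε ≤ ε`, plus `1/(n+1)` because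
the infimum need not be attained. -/
theorem exists_tendsto_zero_of_forall_tendsto {P : ℕ → ℝ → ℝ≥0∞} (hP : ∀ n, Antitone (P n))
    (h1 : ∀ n ε, P n ε ≤ 1) (h : ∀ ε, 0 < ε → Tendsto (fun n => P n ε) atTop (𝓝 0)) :
    ∃ e : ℕ → ℝ, Tendsto e atTop (𝓝 0) ∧ Tendsto (fun n => P n (e n)) atTop (𝓝 0) := by
  set S : ℕ → Set ℝ := fun n => {ε | 0 < ε ∧ P n ε ≤ ENNReal.ofReal ε} with hS
  have hne : ∀ n, (S n).Nonempty := fun n => ⟨1, one_pos, by simpa using h1 n 1⟩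
  have hbdd : ∀ n, BddBelow (S n) := fun n => ⟨0, fun ε hε => hε.1.le⟩
  have h0 : ∀ n, 0 ≤ sInf (S n) := fun n => le_csInf (hne n) fun ε hε => hε.1.le
  have hinf : Tendsto (fun n => sInf (S n)) atTop (𝓝 0) := by
    rw [Metric.tendsto_atTop']
    intro ε hε
    have := (h (ε / 2) (by linarith)).eventually_le_const
      (ENNReal.ofReal_pos.2 (by linarith : 0 < ε / 2))
    obtain ⟨N, hN⟩ := eventually_atTop.1 this
    refine ⟨N, fun n hn => ?_⟩
    rw [Real.dist_eq, sub_zero, abs_of_nonneg (h0 n)]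
    have := csInf_le (hbdd n) (⟨by linarith, hN n hn.le⟩ : ε / 2 ∈ S n)
    linarith
  have he : Tendsto (fun n : ℕ => sInf (S n) + 1 / ((n : ℝ) + 1)) atTop (𝓝 0) := by
    simpa using hinf.add tendsto_one_div_add_atTop_nhds_zero_nat
  refine ⟨_, he, ?_⟩
  have he' := ENNReal.tendsto_ofReal he
  rw [ENNReal.ofReal_zero] at he'
  refine tendsto_of_tendsto_of_tendsto_of_le_of_le tendsto_const_nhds he' (fun n => zero_le) ?_
  intro n
  obtain ⟨ε, hε, hlt⟩ := exists_lt_of_csInf_lt (hne n)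
    (lt_add_of_pos_right (sInf (S n)) (by positivity : 0 < 1 / ((n : ℝ) + 1)))
  exact (hP n hlt.le).trans (hε.2.trans (ENNReal.ofReal_le_ofReal hlt.le))

theorem exists_aasModularityGE {m : ℕ} (hm : 1 ≤ m) :
    ∃ err : ℕ → ℝ, Tendsto err atTop (𝓝 0) ∧
      AASModularityGE m (fun n => binomialMeanDeviation m / m + err n) := by
  obtain ⟨e, he, hP⟩ := exists_tendsto_zero_of_forall_tendsto
    (P := fun n ε => probModularityLT m n (binomialMeanDeviation m / m - ε))
    (fun n _ _ h => probModularityLT_mono m n (by linarith)) (fun n ε => prob_le_one)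
    (fun ε hε => tendsto_probModularityLT hm hε)
  refine ⟨fun n => -e n, by simpa using he.neg, aasModularityGE_of_tendsto ?_⟩
  simpa only [← sub_eq_add_neg] using hP

theorem aasModularityGE_div_sqrt {m : ℕ} (hm : 1 ≤ m) :
    AASModularityGE m (fun _ => (1 / 18) / √(m : ℝ)) := by
  have hm' : (0 : ℝ) < m := by exact_mod_cast hm
  have hs : 0 < √(m : ℝ) := Real.sqrt_pos.2 hm'
  -- The walk bound gives `(1/9)/√m`; halving it makes the inequality strict, and the difference
  -- serves as `ε`.
  have hlt : (1 / 18) / √(m : ℝ) < binomialMeanDeviation m / m := by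
    have h := le_walkMeanAbs hm
    rw [walkMeanAbs_eq] at h
    have h2 : (1 / 9) * √(m : ℝ) ≤ binomialMeanDeviation m := by linarith
    rw [div_lt_div_iff₀ hs hm']
    have h3 := mul_le_mul_of_nonneg_right h2 hs.le
    rw [mul_assoc, Real.mul_self_sqrt hm'.le] at h3
    linarith
  refine aasModularityGE_of_tendsto ?_
  have := tendsto_probModularityLT hm (sub_pos.2 hlt)
  simpa only [sub_sub_cancel] using this

end

theorem mainTheorem4 :
    (∀ m : ℕ, 1 ≤ m →
      (∃ err : ℕ → ℝ, Tendsto err atTop (𝓝 0) ∧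
        AASModularityGE m (fun n => binomialMeanDeviation m / m + err n)) ∧
      binomialMeanDeviation m / m = explicitBound m ∧
      (∃ err : ℕ → ℝ, Tendsto err atTop (𝓝 0) ∧
        AASModularityGE m (fun n => explicitBound m + err n))) ∧
    (∃ c : ℝ, 0 < c ∧ ∀ m : ℕ, 1 ≤ m → AASModularityGE m (fun _ => c / √(m : ℝ))) := by
  refine ⟨fun m hm => ⟨exists_aasModularityGE hm, binomialMeanDeviation_div_eq_explicitBound m,
    ?_⟩, 1 / 18, by norm_num, fun m hm => aasModularityGE_div_sqrt hm⟩
  rw [← binomialMeanDeviation_div_eq_explicitBound m]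
  exact exists_aasModularityGE hm
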